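/- Let $T>0$, let $\Omega=\prod_{i=1}^n(a_i,b_i)\subset\mathbb R^n$ be a bounded open box, and let $\gamma>0$. Let $H^{-1}_0(\Omega)$ be the dual space of $H^1(\Omega)$, where $H^1(\Omega)$ carries the norm $\|f\|_{H^1(\Omega)}^2=\gamma\|f\|_{L^2(\Omega)}^2+\|\nabla f\|_{L^2(\Omega)}^2$. An element $u\in L^2(\Omega)$ acts on $H^1(\Omega)$ by $g\mapsto\int_\Omega u\,g\,dx$. A $C^r$ motion over an interval $I$ is a map $\Phi:I\times\mathbb R^n\to\mathbb R^n$ that is of class $C^r$ in $(t,x)$ (up to the end points that belong to $I$) and such that for each $t\in I$ the map $\Phi(t,\cdot)$ is a $C^r$ diffeomorphism of $\mathbb R^n$; put $\Gamma(t,\cdot)=\Phi(t,\cdot)^{-1}$. Its velocity is the vector field $V$ with $V(t,\Phi(t,y))=\partial_t\Phi(t,y)$, i.e. $V(t,x)=(\partial_t\Phi)(t,\Gamma(t,x))$. Let $\xi:\mathbb R^n\to\mathbb R$ be a Lebesgue measurable function (the static object) that does not leave $\Omega$: $\Phi(t,y)\in\Omega$ for all $t\in I$ and all $y$ with $\xi(y)\neq0$.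 Let $\vartheta\in L^2(0,T;L^2(\Omega))$ and $V\in L^\infty(0,T;L^\infty(\Omega))$, and suppose that one of the following holds. (a) (Mass is conserved, so that formally $\partial_t\vartheta=-\operatorname{div}(\vartheta V)$.) $\Phi$ is a $C^1$ motion over $I=(0,T)$ and $\vartheta(t,x)=\xi(\Gamma(t,x))\,|\det\nabla\Gamma(t,x)|$ for almost every $(t,x)\in(0,T)\times\Omega$. (b) (Intensity is conserved, so that formally $\partial_t\vartheta=-V\cdot\nabla\vartheta$.) $\Phi$ is a $C^2$ motion over $I=[0,T]$ and $\vartheta(t,x)=\xi(\Gamma(t,x))$ for almost every $(t,x)\in(0,T)\times\Omega$. Then $\partial_t\vartheta\in L^2(0,T;H^{-1}_0(\Omega))$. That is, there is a Bochner square-integrable $\eta:(0,T)\to H^{-1}_0(\Omega)$ with $$\int_0^T\varphi'(t)\int_\Omega\vartheta(t,x)\,g(x)\,dx\,dt=-\int_0^T\varphi(t)\,\langle\eta(t),g\rangle\,dt\qquad\text{for all }\varphi\in C_c^\infty(0,T),\ g\in H^1(\Omega).$$ -/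

import Mathlib

open MeasureTheory Set
open scoped ContDiff InnerProductSpace

/-- The open axis-parallel box with corners `a` and `b` in Euclidean space. -/
def openBox {n : ℕ} (a b : Fin n → ℝ) : Set (EuclideanSpace ℝ (Fin n)) :=
  {x | ∀ i, a i < x i ∧ x i < b i}

/-- `G` is the weak gradient of `f` on `Ω`:
the integral of `f ∇φ` is minus the integral of `φ G` for all test functions `φ` on `Ω`. -/
def IsWeakGradient {n : ℕ} (Ω : Set (EuclideanSpace ℝ (Fin n)))
    (f : EuclideanSpace ℝ (Fin n) → ℝ)
    (G : EuclideanSpace ℝ (Fin n) → EuclideanSpace ℝ (Fin n)) : Prop :=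
  ∀ φ : EuclideanSpace ℝ (Fin n) → ℝ, ContDiff ℝ ∞ φ → HasCompactSupport φ → tsupport φ ⊆ Ω →
    ∫ x in Ω, f x • gradient φ x = - ∫ x in Ω, φ x • G x

theorem gradient_continuous_of_smooth {n : ℕ} {φ : EuclideanSpace ℝ (Fin n) → ℝ}
    (hφ : ContDiff ℝ ∞ φ) : Continuous (gradient φ) :=
  (InnerProductSpace.toDual ℝ (EuclideanSpace ℝ (Fin n))).symm.continuous.comp
    (hφ.continuous_fderiv (by simp))

theorem gradient_hasCompactSupport {n : ℕ} {φ : EuclideanSpace ℝ (Fin n) → ℝ}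
    (hc : HasCompactSupport φ) : HasCompactSupport (gradient φ) :=
  (hc.fderiv ℝ).comp_left
    (g := (InnerProductSpace.toDual ℝ (EuclideanSpace ℝ (Fin n))).symm) (map_zero _)

theorem integrable_Lp_smul_gradient {n : ℕ} {Ω : Set (EuclideanSpace ℝ (Fin n))}
    {φ : EuclideanSpace ℝ (Fin n) → ℝ} (hφ : ContDiff ℝ ∞ φ) (hc : HasCompactSupport φ)
    (f : Lp ℝ 2 (volume.restrict Ω)) :
    Integrable (fun x => f x • gradient φ x) (volume.restrict Ω) :=
  memLp_one_iff_integrable.1 (((gradient_continuous_of_smooth hφ).memLp_of_hasCompactSupport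
    (p := 2) (gradient_hasCompactSupport hc)).smul (Lp.memLp f))

theorem integrable_smul_Lp {n : ℕ} {Ω : Set (EuclideanSpace ℝ (Fin n))}
    {φ : EuclideanSpace ℝ (Fin n) → ℝ} (hφ : ContDiff ℝ ∞ φ) (hc : HasCompactSupport φ)
    (G : Lp (EuclideanSpace ℝ (Fin n)) 2 (volume.restrict Ω)) :
    Integrable (fun x => φ x • G x) (volume.restrict Ω) :=
  memLp_one_iff_integrable.1 ((Lp.memLp G).smul
    (hφ.continuous.memLp_of_hasCompactSupport (p := 2) hc))

/-- The pairs `(f, ∇f)` with `f` and its weak gradient `∇f` in `L²(Ω)`. -/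
noncomputable def sobolevGraph {n : ℕ} (Ω : Set (EuclideanSpace ℝ (Fin n))) :
    Submodule ℝ (Lp ℝ 2 (volume.restrict Ω) ×
      Lp (EuclideanSpace ℝ (Fin n)) 2 (volume.restrict Ω)) where
  carrier := {p | IsWeakGradient Ω p.1 p.2}
  zero_mem' := by
    intro φ _ _ _
    have h1 : (fun x => (0 : Lp ℝ 2 (volume.restrict Ω)) x • gradient φ x)
        =ᵐ[volume.restrict Ω] fun _ => 0 := by
      filter_upwards [Lp.coeFn_zero ℝ 2 (volume.restrict Ω)] with x hx
      rw [hx, Pi.zero_apply, zero_smul]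
    have h2 : (fun x => φ x • (0 : Lp (EuclideanSpace ℝ (Fin n)) 2 (volume.restrict Ω)) x)
        =ᵐ[volume.restrict Ω] fun _ => 0 := by
      filter_upwards [Lp.coeFn_zero (EuclideanSpace ℝ (Fin n)) 2 (volume.restrict Ω)] with x hx
      rw [hx, Pi.zero_apply, smul_zero]
    simp only [Prod.fst_zero, Prod.snd_zero]
    rw [integral_congr_ae h1, integral_congr_ae h2]
    simp
  add_mem' := by
    intro p q hp hq φ hφ hc hs
    have h1 : (fun x => (p.1 + q.1) x • gradient φ x)
        =ᵐ[volume.restrict Ω] fun x => p.1 x • gradient φ x + q.1 x • gradient φ x := by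
      filter_upwards [Lp.coeFn_add p.1 q.1] with x hx
      rw [hx, Pi.add_apply, add_smul]
    have h2 : (fun x => φ x • (p.2 + q.2) x)
        =ᵐ[volume.restrict Ω] fun x => φ x • p.2 x + φ x • q.2 x := by
      filter_upwards [Lp.coeFn_add p.2 q.2] with x hx
      rw [hx, Pi.add_apply, smul_add]
    simp only [Prod.fst_add, Prod.snd_add]
    rw [integral_congr_ae h1, integral_congr_ae h2,
      integral_add (integrable_Lp_smul_gradient hφ hc _) (integrable_Lp_smul_gradient hφ hc _),
      integral_add (integrable_smul_Lp hφ hc _) (integrable_smul_Lp hφ hc _),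
      hp φ hφ hc hs, hq φ hφ hc hs]
    abel
  smul_mem' := by
    intro c p hp φ hφ hc hs
    have h1 : (fun x => (c • p.1) x • gradient φ x)
        =ᵐ[volume.restrict Ω] fun x => c • (p.1 x • gradient φ x) := by
      filter_upwards [Lp.coeFn_smul c p.1] with x hx
      rw [hx, Pi.smul_apply, smul_assoc]
    have h2 : (fun x => φ x • (c • p.2) x)
        =ᵐ[volume.restrict Ω] fun x => c • (φ x • p.2 x) := by
      filter_upwards [Lp.coeFn_smul c p.2] with x hx
      rw [hx, Pi.smul_apply, smul_comm]
    simp only [Prod.smul_fst, Prod.smul_snd]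
    rw [integral_congr_ae h1, integral_congr_ae h2, integral_smul, integral_smul,
      hp φ hφ hc hs, smul_neg]

/-- The Sobolev space `H¹(Ω)`; `γ` is the weight in its norm,
`‖f‖² = γ ‖f‖²_{L²} + ‖∇f‖²_{L²}`. -/
def H1 {n : ℕ} (Ω : Set (EuclideanSpace ℝ (Fin n))) (_γ : ℝ) : Type :=
  sobolevGraph Ω

noncomputable instance H1.instAddCommGroup {n : ℕ} (Ω : Set (EuclideanSpace ℝ (Fin n))) (γ : ℝ) :
    AddCommGroup (H1 Ω γ) :=
  inferInstanceAs (AddCommGroup (sobolevGraph Ω))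

noncomputable instance H1.instModule {n : ℕ} (Ω : Set (EuclideanSpace ℝ (Fin n))) (γ : ℝ) :
    Module ℝ (H1 Ω γ) :=
  inferInstanceAs (Module ℝ (sobolevGraph Ω))

/-- The function in `L²(Ω)` underlying an element of `H¹(Ω)`. -/
noncomputable def H1.fn {n : ℕ} {Ω : Set (EuclideanSpace ℝ (Fin n))} {γ : ℝ} :
    H1 Ω γ →ₗ[ℝ] Lp ℝ 2 (volume.restrict Ω) :=
  (LinearMap.fst ℝ _ _).comp (sobolevGraph Ω).subtype

/-- The weak gradient of an element of `H¹(Ω)`. -/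
noncomputable def H1.grad {n : ℕ} {Ω : Set (EuclideanSpace ℝ (Fin n))} {γ : ℝ} :
    H1 Ω γ →ₗ[ℝ] Lp (EuclideanSpace ℝ (Fin n)) 2 (volume.restrict Ω) :=
  (LinearMap.snd ℝ _ _).comp (sobolevGraph Ω).subtype

/-- The inner product `⟪f, g⟫ = γ ⟪f, g⟫_{L²} + ⟪∇f, ∇g⟫_{L²}` on `H¹(Ω)`. -/
@[reducible]
noncomputable def H1.core {n : ℕ} (Ω : Set (EuclideanSpace ℝ (Fin n))) (γ : ℝ)
    [hγ : Fact (0 < γ)] : InnerProductSpace.Core ℝ (H1 Ω γ) where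
  inner f g := γ * ⟪H1.fn f, H1.fn g⟫_ℝ + ⟪H1.grad f, H1.grad g⟫_ℝ
  conj_inner_symm f g := by
    simp [real_inner_comm]
  re_inner_nonneg f := by
    have h1 : 0 ≤ ⟪H1.fn f, H1.fn f⟫_ℝ := real_inner_self_nonneg
    have h2 : 0 ≤ ⟪H1.grad f, H1.grad f⟫_ℝ := real_inner_self_nonneg
    exact add_nonneg (mul_nonneg hγ.out.le h1) h2
  add_left f g h := by
    simp only [map_add, inner_add_left]
    ring
  smul_left f g r := by
    simp only [map_smul, real_inner_smul_left]
    simp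
    ring
  definite f hf := by
    have h1 : 0 ≤ ⟪H1.fn f, H1.fn f⟫_ℝ := real_inner_self_nonneg
    have h2 : 0 ≤ ⟪H1.grad f, H1.grad f⟫_ℝ := real_inner_self_nonneg
    have h3 : γ * ⟪H1.fn f, H1.fn f⟫_ℝ + ⟪H1.grad f, H1.grad f⟫_ℝ = 0 := hf
    have h4 : 0 ≤ γ * ⟪H1.fn f, H1.fn f⟫_ℝ := mul_nonneg hγ.out.le h1
    have h5 : γ * ⟪H1.fn f, H1.fn f⟫_ℝ = 0 := by linarith
    have h6 : ⟪H1.grad f, H1.grad f⟫_ℝ = 0 := by linarith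
    have h7 : ⟪H1.fn f, H1.fn f⟫_ℝ = 0 := by
      rcases mul_eq_zero.1 h5 with h | h
      · exact absurd h hγ.out.ne'
      · exact h
    exact Subtype.ext (Prod.ext (inner_self_eq_zero.1 h7) (inner_self_eq_zero.1 h6))

noncomputable instance H1.instNormedAddCommGroup {n : ℕ} (Ω : Set (EuclideanSpace ℝ (Fin n)))
    (γ : ℝ) [Fact (0 < γ)] : NormedAddCommGroup (H1 Ω γ) :=
  (H1.core Ω γ).toNormedAddCommGroup

noncomputable instance H1.instInnerProductSpace {n : ℕ} (Ω : Set (EuclideanSpace ℝ (Fin n)))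
    (γ : ℝ) [Fact (0 < γ)] : InnerProductSpace ℝ (H1 Ω γ) :=
  InnerProductSpace.ofCore (H1.core Ω γ).toCore

theorem H1.norm_sq {n : ℕ} {Ω : Set (EuclideanSpace ℝ (Fin n))} {γ : ℝ} [Fact (0 < γ)]
    (f : H1 Ω γ) : ‖f‖ ^ 2 = γ * ‖H1.fn f‖ ^ 2 + ‖H1.grad f‖ ^ 2 := by
  rw [← real_inner_self_eq_norm_sq, ← real_inner_self_eq_norm_sq, ← real_inner_self_eq_norm_sq]
  rfl

/-- `H₀⁻¹(Ω)`: the dual space of the whole space `H¹(Ω)`, with the dual norm. -/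
abbrev Hneg1 {n : ℕ} (Ω : Set (EuclideanSpace ℝ (Fin n))) (γ : ℝ) [Fact (0 < γ)] : Type :=
  StrongDual ℝ (H1 Ω γ)

/-- `u ∈ Lᵖ(0,T;Lᵖ(Ω))`, as a function on the space-time cylinder. -/
def MemSpaceTimeLp {n : ℕ} {F : Type*} [NormedAddCommGroup F] (p : ENNReal) (T : ℝ)
    (Ω : Set (EuclideanSpace ℝ (Fin n))) (u : ℝ → EuclideanSpace ℝ (Fin n) → F) : Prop :=
  MemLp (Function.uncurry u) p (volume.restrict (Ioo 0 T ×ˢ Ω))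

/-- `η` is the weak time derivative of `ϑ` on `(0,T)` as a function with values in `H₀⁻¹(Ω)`,
where `ϑ(t) ∈ L²(Ω)` acts on `H¹(Ω)` by integration over `Ω`. -/
def IsWeakTimeDeriv {n : ℕ} (T : ℝ) (Ω : Set (EuclideanSpace ℝ (Fin n))) (γ : ℝ)
    [Fact (0 < γ)] (ϑ : ℝ → EuclideanSpace ℝ (Fin n) → ℝ) (η : ℝ → Hneg1 Ω γ) : Prop :=
  ∀ φ : ℝ → ℝ, ContDiff ℝ ∞ φ → HasCompactSupport φ → tsupport φ ⊆ Ioo 0 T → ∀ g : H1 Ω γ,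
    ∫ t in Ioo 0 T, deriv φ t * ∫ x in Ω, ϑ t x * H1.fn g x = - ∫ t in Ioo 0 T, φ t * η t g

/-- `∂ₜϑ ∈ L²(0,T;H₀⁻¹(Ω))` (Bochner space). -/
def TimeDerivMemL2Hneg1 {n : ℕ} (T : ℝ) (Ω : Set (EuclideanSpace ℝ (Fin n))) (γ : ℝ)
    [Fact (0 < γ)] (ϑ : ℝ → EuclideanSpace ℝ (Fin n) → ℝ) : Prop :=
  ∃ η : ℝ → Hneg1 Ω γ, MemLp η 2 (volume.restrict (Ioo 0 T)) ∧ IsWeakTimeDeriv T Ω γ ϑ η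

/-- A motion of class `C^r` over the time interval `I`: `Φ` is `C^r` in time and space, and
every `Φ(t,·)` is a `C^r` diffeomorphism of the whole space with inverse `Γ(t,·)`. -/
structure IsMotion {n : ℕ} (r : ℕ) (I : Set ℝ)
    (Φ Γ : ℝ → EuclideanSpace ℝ (Fin n) → EuclideanSpace ℝ (Fin n)) : Prop where
  contDiffOn : ContDiffOn ℝ r (Function.uncurry Φ) (I ×ˢ univ)
  contDiff_inverse : ∀ t ∈ I, ContDiff ℝ r (Γ t)
  leftInverse : ∀ t ∈ I, Function.LeftInverse (Γ t) (Φ t)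
  rightInverse : ∀ t ∈ I, Function.RightInverse (Γ t) (Φ t)

/-- The velocity field of the motion: `V(t,x)` is the time derivative of the trajectory that
passes through the point `x` at the time `t`, so that `V(t, Φ(t,y)) = ∂ₜΦ(t,y)`. -/
noncomputable def velocity {n : ℕ}
    (Φ Γ : ℝ → EuclideanSpace ℝ (Fin n) → EuclideanSpace ℝ (Fin n))
    (t : ℝ) (x : EuclideanSpace ℝ (Fin n)) : EuclideanSpace ℝ (Fin n) :=
  deriv (fun s => Φ s (Γ t x)) t

/-- The object `ξ` does not leave `Ω` at any time in `I`. -/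
def StaysIn {n : ℕ} (I : Set ℝ) (Ω : Set (EuclideanSpace ℝ (Fin n)))
    (Φ : ℝ → EuclideanSpace ℝ (Fin n) → EuclideanSpace ℝ (Fin n))
    (ξ : EuclideanSpace ℝ (Fin n) → ℝ) : Prop :=
  ∀ t ∈ I, ∀ y, ξ y ≠ 0 → Φ t y ∈ Ω

/-- `ϑ(t,x) = ξ(Γ(t,x)) |det ∇Γ(t,x)|`, up to a null set of `(0,T) × Ω`. -/
def ConservesMass {n : ℕ} (T : ℝ) (Ω : Set (EuclideanSpace ℝ (Fin n)))
    (Γ : ℝ → EuclideanSpace ℝ (Fin n) → EuclideanSpace ℝ (Fin n))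
    (ξ : EuclideanSpace ℝ (Fin n) → ℝ) (ϑ : ℝ → EuclideanSpace ℝ (Fin n) → ℝ) : Prop :=
  ∀ᵐ p : ℝ × EuclideanSpace ℝ (Fin n) ∂(volume.restrict (Ioo 0 T ×ˢ Ω)),
    ϑ p.1 p.2 = ξ (Γ p.1 p.2) * |(fderiv ℝ (Γ p.1) p.2).det|

/-- `ϑ(t,x) = ξ(Γ(t,x))`, up to a null set of `(0,T) × Ω`. -/
def ConservesIntensity {n : ℕ} (T : ℝ) (Ω : Set (EuclideanSpace ℝ (Fin n)))
    (Γ : ℝ → EuclideanSpace ℝ (Fin n) → EuclideanSpace ℝ (Fin n))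
    (ξ : EuclideanSpace ℝ (Fin n) → ℝ) (ϑ : ℝ → EuclideanSpace ℝ (Fin n) → ℝ) : Prop :=
  ∀ᵐ p : ℝ × EuclideanSpace ℝ (Fin n) ∂(volume.restrict (Ioo 0 T ×ˢ Ω)),
    ϑ p.1 p.2 = ξ (Γ p.1 p.2)

/-! Both cases are one statement about a density `|det ∇Γ| · (ξ m)(Γ)` whose weight `m` may vary
along trajectories. Mass conservation is `m = 1`. Intensity conservation is `m = |det ∇Φ|`, because
the two Jacobians cancel. Formally `∂ₜϑ = κ - div (ϑ V)`, where `κ` is the same density with `m' =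
∂ₜm` in place of `m`. The candidate is therefore `⟨η(t), g⟩ = ∫ κ g + ∫ ϑ V · ∇g`. It is square
integrable in time because `V` is bounded and `|m'| ≤ C |m|` on the object.

For smooth `g` the weak identity is elementary. In the coordinates `x = Φ(t, y)` the Jacobian
disappears, and for each fixed `y` the integrand is the time derivative of `φ m g(Φ(t, y))`, which
is compactly supported in time (`IsMotion.integral_along_trajectory`).

Passing to `g ∈ H¹(Ω)` is the real issue, since the object may approach `∂Ω`. The identity holds on
each trajectory separately, so it survives restriction to the trajectories that stay at distance `δ`
from the complement of `Ω` during the support of `φ`. For the restricted densities, mollifying `g`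
is harmless: wherever they are nonzero, the gradient of the mollification is the mollification of
the weak gradient (`gradient_mollify`, `integral_prod_add_inner_eq_zero_of_smooth`). A trajectory of
the object over a compact time set is a compact subset of `Ω`, so every relevant trajectory is
admitted once `δ` is small. Dominated convergence finishes
(`IsMotion.integral_transported_sobolev`). No extension or trace theorem is needed.

In the intensity case the bound on `m'` comes from compactness: the logarithmic derivative of the
Jacobian is continuous on `[0,T]` times a compact set of starting points
(`IsMotion.exists_abs_jacobianDeriv_le`). -/

/-! ### Mollification away from the boundary -/

-- Weak convergence of mollifications is enough here. By Fubini the pairing is the mollification at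
-- `0` of the correlation `ψ(w) = ∫ ⟪f x, g(w + x)⟫`, and `ψ` is continuous because translations act
-- continuously on `L²`. Integrability of `f` and `g` serves Fubini only.
open Filter Topology in
theorem tendsto_integral_inner_mollify {n : ℕ} {F : Type*} [NormedAddCommGroup F]
    [InnerProductSpace ℝ F] [CompleteSpace F]
    {f g : EuclideanSpace ℝ (Fin n) → F} (hf : MemLp f 2) (hg : MemLp g 2)
    (hf1 : Integrable f) (hg1 : Integrable g)
    {ρ : ℕ → ContDiffBump (0 : EuclideanSpace ℝ (Fin n))}
    (hρ : Tendsto (fun i => (ρ i).rOut) atTop (𝓝 0)) :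
    Tendsto (fun i => ∫ x, ⟪f x, convolution ((ρ i).normed volume) g
      (ContinuousLinearMap.lsmul ℝ ℝ) volume x⟫_ℝ) atTop (𝓝 (∫ x, ⟪f x, g x⟫_ℝ)) := by
  set ψ : EuclideanSpace ℝ (Fin n) → ℝ := fun w => ∫ x, ⟪f x, g (w + x)⟫_ℝ with hψ
  have : Fact ((2 : ENNReal) ≠ ⊤) := ⟨by simp⟩
  have hψc : Continuous ψ := by
    have h1 : ψ = fun w => ⟪hf.toLp f, (DomAddAct.mk w) +ᵥ (hg.toLp g)⟫_ℝ := by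
      funext w
      rw [L2.inner_def]
      refine integral_congr_ae ?_
      have h2 := (measurePreserving_add_left volume w).quasiMeasurePreserving.ae_eq_comp
        hg.coeFn_toLp
      filter_upwards [hf.coeFn_toLp, DomAddAct.vadd_Lp_ae_eq (DomAddAct.mk w) (hg.toLp g), h2]
        with x hx1 hx2 hx3
      rw [hx1, hx2]
      simp only [Function.comp_apply] at hx3
      simp [hx3]
    rw [h1]
    exact continuous_const.inner ((DomAddAct.continuous_mk).vadd continuous_const)
  have key : ∀ i, ∫ x, ⟪f x, convolution ((ρ i).normed volume) g
      (ContinuousLinearMap.lsmul ℝ ℝ) volume x⟫_ℝ =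
      convolution ((ρ i).normed volume) ψ (ContinuousLinearMap.lsmul ℝ ℝ) volume 0 := by
    intro i
    have hint : Integrable (fun p : EuclideanSpace ℝ (Fin n) × EuclideanSpace ℝ (Fin n) =>
        ((ρ i).normed volume) p.1 * ⟪f p.2, g (p.2 - p.1)⟫_ℝ) (volume.prod volume) := by
      -- `g` is reflected so that the convolution integrand becomes `⟪f x, g (x - t)⟫`.
      have h1 := Integrable.convolution_integrand (innerSL ℝ (E := F)) (μ := volume) (ν := volume)
        hf1 hg1.comp_neg
      obtain ⟨C, hC⟩ := (ρ i).hasCompactSupport_normed (μ := volume).exists_bound_of_continuous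
        (ρ i).continuous_normed
      refine (h1.bdd_mul (c := C) ((ρ i).continuous_normed (μ := volume).comp
        continuous_fst).aestronglyMeasurable (Eventually.of_forall fun p => hC p.1)).congr
        (Eventually.of_forall fun p => ?_)
      change _ * ⟪f p.2, g (-(p.1 - p.2))⟫_ℝ = _
      rw [neg_sub]
      rfl
    calc _ = ∫ x, ∫ t, ((ρ i).normed volume) t * ⟪f x, g (x - t)⟫_ℝ := by
            refine integral_congr_ae (Eventually.of_forall fun x => ?_)
            simp only [convolution_def, ContinuousLinearMap.lsmul_apply]
            have hcx : Integrable (fun t => ((ρ i).normed volume) t • g (x - t)) := by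
              obtain ⟨C, hC⟩ := (ρ i).hasCompactSupport_normed
                (μ := volume).exists_bound_of_continuous (ρ i).continuous_normed
              exact (hg1.comp_sub_left x).bdd_smul C
                ((ρ i).continuous_normed (μ := volume)).aestronglyMeasurable
                (Eventually.of_forall hC)
            rw [← integral_inner hcx]
            simp only [real_inner_smul_right]
      _ = ∫ t, ∫ x, ((ρ i).normed volume) t * ⟪f x, g (x - t)⟫_ℝ :=
            (integral_integral_swap hint).symm
      _ = _ := by
            simp only [convolution_def, ContinuousLinearMap.lsmul_apply, hψ, smul_eq_mul,
              integral_const_mul]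
            congr 1; funext t; congr 2; funext x; congr 2; abel
  simp only [key]
  have h0 : ∫ x, ⟪f x, g x⟫_ℝ = ψ 0 := by simp [hψ]
  rw [h0]
  exact ContDiffBump.convolution_tendsto_right_of_continuous hρ hψc 0

theorem MeasureTheory.MemLp.integrable_of_support_subset {n : ℕ} {F : Type*} [NormedAddCommGroup F]
    {Ω : Set (EuclideanSpace ℝ (Fin n))} (hΩ : MeasurableSet Ω) (hΩb : volume Ω ≠ ⊤)
    {f : EuclideanSpace ℝ (Fin n) → F} (hf : MemLp f 2) (hs : ∀ᵐ x, f x ≠ 0 → x ∈ Ω) :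
    Integrable f := by
  have : IsFiniteMeasure (volume.restrict Ω) := ⟨by simpa using hΩb.lt_top⟩
  have h1 : IntegrableOn f Ω := (hf.restrict Ω).integrable (by norm_num)
  refine (h1.integrable_indicator hΩ).congr ?_
  filter_upwards [hs] with x hx
  by_cases h : x ∈ Ω
  · simp [h]
  · simp only [h, not_false_eq_true, indicator_of_notMem]
    by_contra h2
    exact h (hx (Ne.symm h2))

-- The kernel `z ↦ ρ(x - z)` is itself an admissible test function on `Ω` when the ball around `x`
-- fits. The sign from differentiating in `z` cancels the sign in the definition of the weak
-- gradient.
open Filter in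
theorem gradient_mollify {n : ℕ} {Ω : Set (EuclideanSpace ℝ (Fin n))} (hΩ : IsOpen Ω)
    {f : EuclideanSpace ℝ (Fin n) → ℝ}
    {G : EuclideanSpace ℝ (Fin n) → EuclideanSpace ℝ (Fin n)} (h : IsWeakGradient Ω f G)
    (hf : IntegrableOn f Ω)
    (ρ : ContDiffBump (0 : EuclideanSpace ℝ (Fin n))) {x : EuclideanSpace ℝ (Fin n)} {δ : ℝ}
    (hδ : ρ.rOut < δ) (hx : Metric.ball x δ ⊆ Ω) :
    gradient (convolution (ρ.normed volume) (Ω.indicator f)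
      (ContinuousLinearMap.lsmul ℝ ℝ) volume) x =
    convolution (ρ.normed volume) (Ω.indicator G) (ContinuousLinearMap.lsmul ℝ ℝ) volume x := by
  set r := ρ.normed volume with hr
  have hrc : ContDiff ℝ ∞ r := ρ.contDiff_normed
  have hrs : HasCompactSupport r := ρ.hasCompactSupport_normed
  have hfi : Integrable (Ω.indicator f) := hf.integrable_indicator hΩ.measurableSet
  have h1 := (hrs.hasFDerivAt_convolution_left (ContinuousLinearMap.lsmul ℝ ℝ)
    (hrc.of_le (by simp)) hfi.locallyIntegrable x)
  have h2 : gradient (fun z => r (x - z)) = fun z => - gradient r (x - z) := by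
    funext z
    have : fderiv ℝ (fun z => r (x - z)) z = - fderiv ℝ r (x - z) := by
      have h5 := (hrc.differentiable (by simp) (x - z)).hasFDerivAt.comp z
        ((hasFDerivAt_id z).const_sub x)
      refine (HasFDerivAt.fderiv (f := fun z => r (x - z)) h5).trans ?_
      ext u
      simp
    rw [gradient, gradient, this, map_neg]
  have h3 := h (fun z => r (x - z)) (hrc.comp (contDiff_const.sub contDiff_id))
    (hrs.comp_homeomorph (Homeomorph.subLeft x)) (by
      have e1 : tsupport (fun z => r (x - z)) ⊆ Metric.closedBall x ρ.rOut := by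
        refine closure_minimal ?_ Metric.isClosed_closedBall
        intro z hz
        have : x - z ∈ tsupport r := subset_tsupport _ hz
        rw [hr, ρ.tsupport_normed_eq] at this
        simpa [dist_eq_norm, norm_sub_rev] using this
      exact e1.trans ((Metric.closedBall_subset_ball hδ).trans hx))
  rw [h2] at h3
  simp only [smul_neg, integral_neg, neg_inj] at h3
  have h4 : convolution r (Ω.indicator G) (ContinuousLinearMap.lsmul ℝ ℝ) volume x =
      ∫ z in Ω, r (x - z) • G z := by
    rw [convolution_eq_swap, ← integral_indicator hΩ.measurableSet]
    congr 1; funext z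
    by_cases hz : z ∈ Ω <;> simp [hz]
  rw [h4, ← h3]
  rw [gradient, h1.fderiv, LinearIsometryEquiv.symm_apply_eq]
  rw [convolution_eq_swap]
  obtain ⟨C, hC⟩ := (gradient_hasCompactSupport hrs).exists_bound_of_continuous
    (gradient_continuous_of_smooth hrc)
  have hgi : Integrable (fun z => f z • gradient r (x - z)) (volume.restrict Ω) :=
    hf.smul_bdd C (((gradient_continuous_of_smooth hrc).comp
      (continuous_const.sub continuous_id)).aestronglyMeasurable)
      (Eventually.of_forall fun z => hC _)
  have h5 := ContinuousLinearMap.integral_comp_comm (innerSL ℝ) hgi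
  have h6 : ∀ v : EuclideanSpace ℝ (Fin n),
      InnerProductSpace.toDual ℝ (EuclideanSpace ℝ (Fin n)) v = innerSL ℝ v := fun v => rfl
  rw [h6, ← h5, ← integral_indicator hΩ.measurableSet]
  congr 1; funext z
  ext u
  by_cases hz : z ∈ Ω
  · have h7 : (innerSL ℝ) (gradient r (x - z)) u = fderiv ℝ r (x - z) u := by
      simp [gradient]
    simp [hz, mul_comm, h7]
  · simp [hz]

-- The mollification of `u`, extended by zero, is an admissible smooth `G`. Near `∂Ω` its gradient
-- may differ from the mollified `U`, but `H` vanishes there.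
open Filter Topology in
theorem integral_add_inner_eq_zero_of_smooth {n : ℕ} {Ω : Set (EuclideanSpace ℝ (Fin n))}
    (hΩ : IsOpen Ω) (hΩb : Bornology.IsBounded Ω)
    {f : EuclideanSpace ℝ (Fin n) → ℝ} {H : EuclideanSpace ℝ (Fin n) → EuclideanSpace ℝ (Fin n)}
    (hf : MemLp f 2) (hH : MemLp H 2) {δ : ℝ} (hδ : 0 < δ)
    (hfs : ∀ᵐ x, f x ≠ 0 → Metric.ball x δ ⊆ Ω) (hHs : ∀ᵐ x, H x ≠ 0 → Metric.ball x δ ⊆ Ω)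
    (h : ∀ G : EuclideanSpace ℝ (Fin n) → ℝ, ContDiff ℝ ∞ G → HasCompactSupport G →
      (∫ x, ⟪f x, G x⟫_ℝ) + ∫ x, ⟪H x, gradient G x⟫_ℝ = 0)
    {u : EuclideanSpace ℝ (Fin n) → ℝ} {U : EuclideanSpace ℝ (Fin n) → EuclideanSpace ℝ (Fin n)}
    (hu : MemLp u 2 (volume.restrict Ω)) (hU : MemLp U 2 (volume.restrict Ω))
    (huU : IsWeakGradient Ω u U) :
    (∫ x in Ω, ⟪f x, u x⟫_ℝ) + ∫ x in Ω, ⟪H x, U x⟫_ℝ = 0 := by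
  have hΩm := hΩ.measurableSet
  have hΩv : volume Ω ≠ ⊤ := hΩb.measure_lt_top.ne
  have : IsFiniteMeasure (volume.restrict Ω) := ⟨by simpa using hΩv.lt_top⟩
  have hball : ∀ x, Metric.ball x δ ⊆ Ω → x ∈ Ω := fun x hx => hx (Metric.mem_ball_self hδ)
  have hf1 : Integrable f := hf.integrable_of_support_subset hΩm hΩv
    (hfs.mono fun x hx h => hball x (hx h))
  have hH1 : Integrable H := hH.integrable_of_support_subset hΩm hΩv
    (hHs.mono fun x hx h => hball x (hx h))
  have hui : IntegrableOn u Ω := hu.integrable (by norm_num)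
  have hUi : IntegrableOn U Ω := hU.integrable (by norm_num)
  let ρ : ℕ → ContDiffBump (0 : EuclideanSpace ℝ (Fin n)) := fun i =>
    ⟨1 / ((i : ℝ) + 1) / 2, 1 / ((i : ℝ) + 1), by positivity, half_lt_self (by positivity)⟩
  have hρ : Tendsto (fun i => (ρ i).rOut) atTop (𝓝 0) := tendsto_one_div_add_atTop_nhds_zero_nat
  have t1 := tendsto_integral_inner_mollify hf ((memLp_indicator_iff_restrict hΩm).2 hu) hf1
    (hui.integrable_indicator hΩm) hρ
  have t2 := tendsto_integral_inner_mollify hH ((memLp_indicator_iff_restrict hΩm).2 hU) hH1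
    (hUi.integrable_indicator hΩm) hρ
  have e1 : ∫ x, ⟪f x, Ω.indicator u x⟫_ℝ = ∫ x in Ω, ⟪f x, u x⟫_ℝ := by
    rw [← integral_indicator hΩm]
    congr 1; funext x
    by_cases hx : x ∈ Ω <;> simp [hx]
  have e2 : ∫ x, ⟪H x, Ω.indicator U x⟫_ℝ = ∫ x in Ω, ⟪H x, U x⟫_ℝ := by
    rw [← integral_indicator hΩm]
    congr 1; funext x
    by_cases hx : x ∈ Ω <;> simp [hx]
  rw [← e1, ← e2]
  refine tendsto_nhds_unique (t1.add t2) (tendsto_const_nhds.congr' ?_)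
  filter_upwards [hρ.eventually (gt_mem_nhds hδ)] with i hi
  have hsm := h (convolution ((ρ i).normed volume) (Ω.indicator u)
    (ContinuousLinearMap.lsmul ℝ ℝ) volume)
    ((ρ i).hasCompactSupport_normed.contDiff_convolution_left _ (ρ i).contDiff_normed
      (hui.integrable_indicator hΩm).locallyIntegrable)
    (by
      refine (ρ i).hasCompactSupport_normed.convolution _ ?_
      exact HasCompactSupport.intro' hΩb.isCompact_closure isClosed_closure
        fun x hx => indicator_of_notMem (fun h => hx (subset_closure h)) _)
  -- The first integrals agree literally; the second agree because the gradient is only seen where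
  -- `H` is nonzero.
  rw [← hsm]
  congr 1
  refine integral_congr_ae ?_
  filter_upwards [hHs] with x hx
  by_cases h0 : H x = 0
  · simp [h0]
  · rw [gradient_mollify hΩ huU hui (ρ i) hi (hx h0)]

/-! ### Functions on space-time as curves in `L²` -/

/-- By the Lindelöf property every open set is a countable union of balls, and preimages of balls
are sublevel sets of distances. -/
theorem measurable_of_measurable_edist {α X : Type*} [MeasurableSpace α] [PseudoEMetricSpace X]
    [SecondCountableTopology X] [MeasurableSpace X] [BorelSpace X] {f : α → X}
    (h : ∀ y, Measurable fun t => edist (f t) y) : Measurable f := by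
  refine measurable_of_isOpen fun U hU => ?_
  choose! ε hε hεU using fun x (hx : x ∈ U) => EMetric.isOpen_iff.1 hU x hx
  obtain ⟨S, hS, hSU⟩ := TopologicalSpace.isOpen_iUnion_countable
    (fun x : U => Metric.eball (x : X) (ε x)) fun x => Metric.isOpen_eball
  have hU' : U = ⋃ i ∈ S, Metric.eball (i : X) (ε i) := by
    rw [hSU]
    refine Subset.antisymm (fun x hx => ?_) (iUnion_subset fun x => hεU x x.2)
    exact mem_iUnion.2 ⟨⟨x, hx⟩, Metric.mem_eball_self (hε x hx)⟩
  rw [hU', preimage_iUnion₂]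
  exact MeasurableSet.biUnion hS fun i _ => h i measurableSet_Iio

theorem measurable_eLpNorm_two_slice {α β F : Type*} [MeasurableSpace α] [MeasurableSpace β]
    {ν : Measure β} [SFinite ν] [NormedAddCommGroup F] {v : α × β → F} (hv : StronglyMeasurable v) :
    Measurable fun t => eLpNorm (fun x => v (t, x)) 2 ν := by
  simp only [eLpNorm_eq_lintegral_rpow_enorm_toReal two_ne_zero ENNReal.ofNat_ne_top]
  exact ((hv.enorm.pow_const _).lintegral_prod_right').pow_const _

/-- Since `L²` is separable, measurability of the curve reduces to that of its distances to fixed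
elements, which Tonelli provides. Tonelli also identifies the two norms. -/
theorem exists_memLp_slices {α β F : Type*} [MeasurableSpace α] [MeasurableSpace β]
    {μ : Measure α} {ν : Measure β} [SFinite ν] [SFinite μ] [NormedAddCommGroup F]
    [MeasurableSpace.CountablyGenerated β] [SecondCountableTopology F]
    {u : α × β → F} (hu : MemLp u 2 (μ.prod ν)) :
    ∃ f : α → Lp F 2 ν, MemLp f 2 μ ∧ ∀ᵐ t ∂μ, f t =ᵐ[ν] fun x => u (t, x) := by
  classical
  have : Fact ((2 : ENNReal) ≠ ⊤) := ⟨by simp⟩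
  set v := hu.1.mk u with hv
  have hvm : StronglyMeasurable v := hu.1.stronglyMeasurable_mk
  have hv2 : MemLp v 2 (μ.prod ν) := (memLp_congr_ae hu.1.ae_eq_mk).1 hu
  have hvs : ∀ t, StronglyMeasurable fun x => v (t, x) := fun t =>
    hvm.comp_measurable measurable_prodMk_left
  have hM : ∀ t, MemLp (fun x => v (t, x)) 2 ν ↔ eLpNorm (fun x => v (t, x)) 2 ν < ⊤ := fun t =>
    ⟨fun h => h.2, fun h => ⟨(hvs t).aestronglyMeasurable, h⟩⟩
  have hfin : ∫⁻ t, ∫⁻ x, ‖v (t, x)‖ₑ ^ (2 : ENNReal).toReal ∂ν ∂μ < ⊤ := by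
    rw [← lintegral_prod _ (hvm.enorm.pow_const _).aemeasurable]
    exact (eLpNorm_lt_top_iff_lintegral_rpow_enorm_lt_top two_ne_zero ENNReal.ofNat_ne_top).1 hv2.2
  have hae : ∀ᵐ t ∂μ, MemLp (fun x => v (t, x)) 2 ν := by
    filter_upwards [ae_lt_top (hvm.enorm.pow_const _).lintegral_prod_right' hfin.ne] with t ht
    exact (hM t).2
      ((eLpNorm_lt_top_iff_lintegral_rpow_enorm_lt_top two_ne_zero ENNReal.ofNat_ne_top).2 ht)
  -- The value `0` is used only on the null set of times whose slice is not in `L²`.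
  let f : α → Lp F 2 ν := fun t =>
    if h : MemLp (fun x => v (t, x)) 2 ν then h.toLp _ else 0
  let _ : MeasurableSpace (Lp F 2 ν) := borel _
  have : BorelSpace (Lp F 2 ν) := ⟨rfl⟩
  have hfm : Measurable f := by
    refine measurable_of_measurable_edist fun y => ?_
    have h1 : (fun t => edist (f t) y) = fun t => if eLpNorm (fun x => v (t, x)) 2 ν < ⊤ then
        eLpNorm (fun x => v (t, x) - y x) 2 ν else edist 0 y := by
      funext t
      by_cases h : MemLp (fun x => v (t, x)) 2 ν
      · simp only [f, h, dite_true, if_pos ((hM t).1 h), Lp.edist_def]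
        refine eLpNorm_congr_ae ?_
        filter_upwards [h.coeFn_toLp] with x hx
        simp [hx]
      · simp only [f, h, dite_false, if_neg (fun h' => h ((hM t).2 h'))]
    rw [h1]
    refine Measurable.ite (measurableSet_lt (measurable_eLpNorm_two_slice hvm) measurable_const) ?_
      measurable_const
    exact measurable_eLpNorm_two_slice (v := fun p => v p - y p.2)
      (hvm.sub ((Lp.stronglyMeasurable y).comp_measurable measurable_snd))
  refine ⟨f, ⟨hfm.stronglyMeasurable.aestronglyMeasurable, ?_⟩, ?_⟩
  · rw [eLpNorm_lt_top_iff_lintegral_rpow_enorm_lt_top two_ne_zero ENNReal.ofNat_ne_top]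
    refine lt_of_le_of_lt (le_of_eq (lintegral_congr_ae ?_)) hfin
    filter_upwards [hae] with t ht
    simp only [f, ht, dite_true, Lp.enorm_toLp]
    rw [eLpNorm_eq_lintegral_rpow_enorm_toReal two_ne_zero ENNReal.ofNat_ne_top,
      ← ENNReal.rpow_mul]
    simp
  · filter_upwards [hae, Measure.ae_ae_of_ae_prod hu.1.ae_eq_mk] with t ht ht2
    simp only [f, ht, dite_true]
    exact ht.coeFn_toLp.trans (ht2.mono fun x hx => hx.symm)

section Pairing

variable {α β F : Type*} [MeasurableSpace α] [MeasurableSpace β] {μ : Measure α} {ν : Measure β}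
  [IsFiniteMeasure μ] [SFinite ν] [NormedAddCommGroup F] [InnerProductSpace ℝ F]

theorem integrable_inner_of_memLp {δ : Type*} [MeasurableSpace δ] {π : Measure δ} {f g : δ → F}
    (hf : MemLp f 2 π) (hg : MemLp g 2 π) : Integrable (fun x => ⟪f x, g x⟫_ℝ) π := by
  refine (hf.norm.integrable_mul hg.norm).mono' (hf.1.inner hg.1)
    (Filter.Eventually.of_forall fun x => ?_)
  exact norm_inner_le_norm (𝕜 := ℝ) (f x) (g x)

theorem integrable_inner_comp_snd {u : α × β → F} (hu : MemLp u 2 (μ.prod ν)) {k : β → F}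
    (hk : MemLp k 2 ν) : Integrable (fun p => ⟪u p, k p.2⟫_ℝ) (μ.prod ν) :=
  integrable_inner_of_memLp hu (hk.comp_snd μ)

omit [MeasurableSpace α] [SFinite ν] in
theorem inner_slice_eq {u : α × β → F} {f : α → Lp F 2 ν} {t : α}
    (h : f t =ᵐ[ν] fun x => u (t, x)) (k : Lp F 2 ν) :
    ⟪f t, k⟫_ℝ = ∫ x, ⟪u (t, x), k x⟫_ℝ ∂ν := by
  rw [L2.inner_def]
  exact integral_congr_ae (h.mono fun x hx => by simp only [hx])

theorem inner_integral_slices [CompleteSpace F] {u : α × β → F} (hu : MemLp u 2 (μ.prod ν))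
    {f : α → Lp F 2 ν}
    (hf : MemLp f 2 μ) (hfu : ∀ᵐ t ∂μ, f t =ᵐ[ν] fun x => u (t, x)) (k : Lp F 2 ν) :
    ⟪∫ t, f t ∂μ, k⟫_ℝ = ∫ p, ⟪u p, k p.2⟫_ℝ ∂(μ.prod ν) := by
  rw [integral_prod _ (integrable_inner_comp_snd hu (Lp.memLp k)), real_inner_comm,
    ← integral_inner (hf.integrable (by norm_num))]
  refine integral_congr_ae (hfu.mono fun t ht => ?_)
  simp only
  rw [real_inner_comm, inner_slice_eq ht]

/-- Pair the time integral `m` with its own restriction to `B`: the result is `‖1_B m‖²`, and by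
Fubini it is also an integral of zero. -/
theorem integral_slices_eq_zero_on [CompleteSpace F] {u : α × β → F} (hu : MemLp u 2 (μ.prod ν))
    {f : α → Lp F 2 ν}
    (hf : MemLp f 2 μ) (hfu : ∀ᵐ t ∂μ, f t =ᵐ[ν] fun x => u (t, x)) {B : Set β}
    (hB : MeasurableSet B) (huB : ∀ᵐ p ∂(μ.prod ν), p.2 ∈ B → u p = 0) :
    ∀ᵐ x ∂ν, x ∈ B → (∫ t, f t ∂μ : Lp F 2 ν) x = 0 := by
  set m : Lp F 2 ν := ∫ t, f t ∂μ with hm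
  have hk : MemLp (B.indicator m) 2 ν := (Lp.memLp m).indicator hB
  have h1 : ⟪m, hk.toLp _⟫_ℝ = 0 := by
    refine (inner_integral_slices hu hf hfu (hk.toLp _)).trans ?_
    refine integral_eq_zero_of_ae ?_
    have h2 := Measure.quasiMeasurePreserving_snd (μ := μ) (ν := ν) |>.ae_eq_comp hk.coeFn_toLp
    filter_upwards [huB, h2] with p hp hp2
    simp only [Function.comp_apply] at hp2
    rw [hp2]
    by_cases h : p.2 ∈ B
    · simp [hp h]
    · simp [h]
  have h3 : ⟪hk.toLp _, hk.toLp _⟫_ℝ = 0 := by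
    rw [← h1, L2.inner_def, L2.inner_def]
    refine integral_congr_ae (hk.coeFn_toLp.mono fun x hx => ?_)
    simp only [hx]
    by_cases h : x ∈ B <;> simp [h]
  have h4 := inner_self_eq_zero.1 h3
  have h5 := hk.coeFn_toLp
  rw [h4] at h5
  filter_upwards [h5, Lp.coeFn_zero F 2 ν] with x hx hx0 hxB
  rw [hx0, indicator_of_mem hxB] at hx
  simpa using hx.symm

end Pairing

theorem measurableSet_ball_subset {X : Type*} [PseudoMetricSpace X] [MeasurableSpace X]
    [OpensMeasurableSpace X] (Ω : Set X) (δ : ℝ) : MeasurableSet {x | Metric.ball x δ ⊆ Ω} := by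
  have : {x | Metric.ball x δ ⊆ Ω} = ⋂ z ∈ Ωᶜ, {x | δ ≤ dist z x} := by
    ext x
    simp only [mem_ofPred_eq, mem_iInter, mem_compl_iff]
    exact ⟨fun h z hz => not_lt.1 fun h' => hz (h h'), fun h z hz => by_contra fun h' =>
      absurd (h z h') (not_le.2 hz)⟩
  rw [this]
  exact (isClosed_biInter fun z _ => isClosed_le continuous_const
    (continuous_const.dist continuous_id)).measurableSet

/-- The test function does not depend on time, so only the Bochner time integrals of `f` and `H`
matter. These inherit the distance from the boundary, and the purely spatial result applies to them.
-/
theorem integral_prod_add_inner_eq_zero_of_smooth {n : ℕ} {μ : Measure ℝ} [IsFiniteMeasure μ]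
    {Ω : Set (EuclideanSpace ℝ (Fin n))}
    (hΩ : IsOpen Ω) (hΩb : Bornology.IsBounded Ω)
    {f : ℝ × EuclideanSpace ℝ (Fin n) → ℝ}
    {H : ℝ × EuclideanSpace ℝ (Fin n) → EuclideanSpace ℝ (Fin n)}
    (hf : MemLp f 2 (μ.prod volume)) (hH : MemLp H 2 (μ.prod volume)) {δ : ℝ} (hδ : 0 < δ)
    (hfs : ∀ᵐ p ∂(μ.prod volume), f p ≠ 0 → Metric.ball p.2 δ ⊆ Ω)
    (hHs : ∀ᵐ p ∂(μ.prod volume), H p ≠ 0 → Metric.ball p.2 δ ⊆ Ω)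
    (h : ∀ G : EuclideanSpace ℝ (Fin n) → ℝ, ContDiff ℝ ∞ G → HasCompactSupport G →
      ∫ p, (⟪f p, G p.2⟫_ℝ + ⟪H p, gradient G p.2⟫_ℝ) ∂(μ.prod volume) = 0)
    {u : EuclideanSpace ℝ (Fin n) → ℝ} {U : EuclideanSpace ℝ (Fin n) → EuclideanSpace ℝ (Fin n)}
    (hu : MemLp u 2 (volume.restrict Ω)) (hU : MemLp U 2 (volume.restrict Ω))
    (huU : IsWeakGradient Ω u U) :
    ∫ p, (⟪f p, u p.2⟫_ℝ + ⟪H p, U p.2⟫_ℝ) ∂(μ.prod (volume.restrict Ω)) = 0 := by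
  obtain ⟨f', hf', hff'⟩ := exists_memLp_slices hf
  obtain ⟨H', hH', hHH'⟩ := exists_memLp_slices hH
  have hB := (measurableSet_ball_subset Ω δ).compl
  have hfB := integral_slices_eq_zero_on hf hf' hff' hB
    (hfs.mono fun p hp hpB => by_contra fun h => hpB (hp h))
  have hHB := integral_slices_eq_zero_on hH hH' hHH' hB
    (hHs.mono fun p hp hpB => by_contra fun h => hpB (hp h))
  have pair : ∀ {F : Type} [NormedAddCommGroup F] [InnerProductSpace ℝ F] [CompleteSpace F]
      {w : ℝ × EuclideanSpace ℝ (Fin n) → F} {w' : ℝ → Lp F 2 (volume : Measure _)}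
      (hw : MemLp w 2 (μ.prod volume)) (hw' : MemLp w' 2 μ)
      (hww' : ∀ᵐ t ∂μ, w' t =ᵐ[volume] fun x => w (t, x)) {k : EuclideanSpace ℝ (Fin n) → F}
      (hk : MemLp k 2 volume),
      ∫ x, ⟪(∫ t, w' t ∂μ : Lp F 2 volume) x, k x⟫_ℝ = ∫ p, ⟪w p, k p.2⟫_ℝ ∂(μ.prod volume) := by
    intro F _ _ _ w w' hw hw' hww' k hk
    have h1 := inner_integral_slices hw hw' hww' (hk.toLp k)
    have h2 := Measure.quasiMeasurePreserving_snd (μ := μ) (ν := volume) |>.ae_eq_comp hk.coeFn_toLp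
    rw [L2.inner_def] at h1
    refine Eq.trans (integral_congr_ae (hk.coeFn_toLp.mono fun x hx => ?_)) (h1.trans ?_)
    · simp only [hx]
    exact integral_congr_ae (h2.mono fun p hp => by
      simp only [Function.comp_apply] at hp
      simp only [hp])
  have hmain := integral_add_inner_eq_zero_of_smooth hΩ hΩb (Lp.memLp (∫ t, f' t ∂μ))
    (Lp.memLp (∫ t, H' t ∂μ)) hδ
    (hfB.mono fun x hx h0 => by_contra fun hc => h0 (hx hc))
    (hHB.mono fun x hx h0 => by_contra fun hc => h0 (hx hc))
    (fun G hG hGc => by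
      have hG2 : MemLp G 2 volume := hG.continuous.memLp_of_hasCompactSupport hGc
      have hG3 : MemLp (gradient G) 2 volume := (gradient_continuous_of_smooth
        hG).memLp_of_hasCompactSupport (gradient_hasCompactSupport hGc)
      rw [pair hf hf' hff' hG2, pair hH hH' hHH' hG3, ← integral_add
        (integrable_inner_comp_snd hf hG2) (integrable_inner_comp_snd hH hG3)]
      exact h G hG hGc) hu hU huU
  have conv : ∀ {F : Type} [NormedAddCommGroup F] [InnerProductSpace ℝ F] [CompleteSpace F]
      {w : ℝ × EuclideanSpace ℝ (Fin n) → F} {w' : ℝ → Lp F 2 (volume : Measure _)}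
      (hw : MemLp w 2 (μ.prod volume)) (hw' : MemLp w' 2 μ)
      (hww' : ∀ᵐ t ∂μ, w' t =ᵐ[volume] fun x => w (t, x)) {k : EuclideanSpace ℝ (Fin n) → F}
      (hk : MemLp k 2 (volume.restrict Ω)),
      ∫ x in Ω, ⟪(∫ t, w' t ∂μ : Lp F 2 volume) x, k x⟫_ℝ =
        ∫ p, ⟪w p, k p.2⟫_ℝ ∂(μ.prod (volume.restrict Ω)) := by
    intro F _ _ _ w w' hw hw' hww' k hk
    have h1 := pair hw hw' hww' ((memLp_indicator_iff_restrict hΩ.measurableSet).2 hk)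
    have e1 : ∀ (a : F) (x : EuclideanSpace ℝ (Fin n)), ⟪a, Ω.indicator k x⟫_ℝ =
        Ω.indicator (fun x => ⟪a, k x⟫_ℝ) x := by
      intro a x
      by_cases hx : x ∈ Ω <;> simp [hx]
    have e2 : μ.prod (volume.restrict Ω) = (μ.prod volume).restrict (univ ×ˢ Ω) := by
      rw [← Measure.prod_restrict, Measure.restrict_univ]
    rw [e2, ← integral_indicator hΩ.measurableSet, ← integral_indicator
      (MeasurableSet.univ.prod hΩ.measurableSet)]
    refine Eq.trans ?_ (h1.trans ?_)
    · exact integral_congr_ae (Filter.Eventually.of_forall fun x => (e1 _ x).symm)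
    · refine integral_congr_ae (Filter.Eventually.of_forall fun p => ?_)
      by_cases hx : p.2 ∈ Ω <;> simp [hx, indicator]
  rw [conv hf hf' hff' hu, conv hH hH' hHH' hU, ← integral_add
    (integrable_inner_comp_snd _ hu) (integrable_inner_comp_snd _ hU)] at hmain
  · exact hmain
  · exact hf.mono_measure (Measure.prod_mono le_rfl Measure.restrict_le_self)
  · exact hH.mono_measure (Measure.prod_mono le_rfl Measure.restrict_le_self)

/-! ### Functionals on `H¹(Ω)` and the candidate derivative -/

/-- The inclusion of `H¹(Ω)` into `L²(Ω)`. -/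
noncomputable def H1.fnL {n : ℕ} (Ω : Set (EuclideanSpace ℝ (Fin n))) (γ : ℝ) [hγ : Fact (0 < γ)] :
    H1 Ω γ →L[ℝ] Lp ℝ 2 (volume.restrict Ω) :=
  LinearMap.mkContinuous H1.fn (√γ)⁻¹ fun f => by
    have h := H1.norm_sq f
    have h0 : 0 < √γ := Real.sqrt_pos.2 hγ.out
    rw [inv_mul_eq_div, le_div_iff₀ h0]
    refine abs_le_of_sq_le_sq' ?_ (norm_nonneg _) |>.2
    rw [mul_pow, Real.sq_sqrt hγ.out.le, h]
    nlinarith [sq_nonneg ‖H1.grad f‖]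

/-- The weak gradient on `H¹(Ω)`. -/
noncomputable def H1.gradL {n : ℕ} (Ω : Set (EuclideanSpace ℝ (Fin n))) (γ : ℝ)
    [hγ : Fact (0 < γ)] : H1 Ω γ →L[ℝ] Lp (EuclideanSpace ℝ (Fin n)) 2 (volume.restrict Ω) :=
  LinearMap.mkContinuous H1.grad 1 fun f => by
    have h := H1.norm_sq f
    rw [one_mul]
    refine abs_le_of_sq_le_sq' ?_ (norm_nonneg _) |>.2
    rw [h]
    nlinarith [mul_nonneg hγ.out.le (sq_nonneg ‖H1.fn f‖)]

/-- The functional on `X` obtained by testing `v` against the image of `L`. -/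
noncomputable def testAgainst {X Y : Type*} [NormedAddCommGroup X] [NormedSpace ℝ X]
    [NormedAddCommGroup Y] [InnerProductSpace ℝ Y] (L : X →L[ℝ] Y) : Y →L[ℝ] StrongDual ℝ X :=
  ((ContinuousLinearMap.compL ℝ X Y ℝ).flip L).comp (innerSL ℝ)

theorem testAgainst_apply {X Y : Type*} [NormedAddCommGroup X] [NormedSpace ℝ X]
    [NormedAddCommGroup Y] [InnerProductSpace ℝ Y] (L : X →L[ℝ] Y) (v : Y) (g : X) :
    testAgainst L v g = ⟪v, L g⟫_ℝ := rfl

/-- The slices of `κ` and `W` are square-integrable curves in `L²`. Continuous linear maps send them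
to the dual of `H¹(Ω)`, so Bochner measurability and the norm bound come together. -/
theorem timeDerivMemL2Hneg1_of_identity {n : ℕ} {T : ℝ} {Ω : Set (EuclideanSpace ℝ (Fin n))}
    {γ : ℝ} [Fact (0 < γ)] {ϑ : ℝ → EuclideanSpace ℝ (Fin n) → ℝ} (hϑ : MemSpaceTimeLp 2 T Ω ϑ)
    {κ : ℝ × EuclideanSpace ℝ (Fin n) → ℝ}
    (hκ : MemLp κ 2 ((volume.restrict (Ioo 0 T)).prod (volume.restrict Ω)))
    {W : ℝ × EuclideanSpace ℝ (Fin n) → EuclideanSpace ℝ (Fin n)}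
    (hW : MemLp W 2 ((volume.restrict (Ioo 0 T)).prod (volume.restrict Ω)))
    (h : ∀ φ : ℝ → ℝ, ContDiff ℝ ∞ φ → HasCompactSupport φ → tsupport φ ⊆ Ioo 0 T → ∀ g : H1 Ω γ,
      ∫ p, (deriv φ p.1 * ⟪ϑ p.1 p.2, H1.fn g p.2⟫_ℝ + (φ p.1 * ⟪κ p, H1.fn g p.2⟫_ℝ
        + φ p.1 * ⟪W p, H1.grad g p.2⟫_ℝ))
        ∂((volume.restrict (Ioo 0 T)).prod (volume.restrict Ω)) = 0) :
    TimeDerivMemL2Hneg1 T Ω γ ϑ := by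
  have hϑ' : MemLp (fun p : ℝ × EuclideanSpace ℝ (Fin n) => ϑ p.1 p.2) 2
      ((volume.restrict (Ioo 0 T)).prod (volume.restrict Ω)) := by
    rw [Measure.prod_restrict, ← Measure.volume_eq_prod]
    exact hϑ
  obtain ⟨k, hk, hkκ⟩ := exists_memLp_slices hκ
  obtain ⟨w, hw, hwW⟩ := exists_memLp_slices hW
  refine ⟨fun t => testAgainst (H1.fnL Ω γ) (k t) + testAgainst (H1.gradL Ω γ) (w t),
    ((testAgainst (H1.fnL Ω γ)).comp_memLp' hk).add ((testAgainst (H1.gradL Ω γ)).comp_memLp' hw),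
    fun φ hφ hφc hφs g => ?_⟩
  have bdd : ∀ {ψ : ℝ → ℝ} {q : ℝ × EuclideanSpace ℝ (Fin n) → ℝ}, Continuous ψ →
      HasCompactSupport ψ → Integrable q ((volume.restrict (Ioo 0 T)).prod (volume.restrict Ω)) →
      Integrable (fun p => ψ p.1 * q p)
        ((volume.restrict (Ioo 0 T)).prod (volume.restrict Ω)) := by
    intro ψ q hψ hψc hq
    obtain ⟨C, hC⟩ := hψc.exists_bound_of_continuous hψ
    exact hq.bdd_mul (hψ.comp continuous_fst).aestronglyMeasurable
      (Filter.Eventually.of_forall fun p => hC p.1)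
  have hφ' : Continuous (deriv φ) := hφ.continuous_deriv (by simp)
  have i1 := bdd hφ' hφc.deriv (integrable_inner_comp_snd hϑ' (Lp.memLp (H1.fn g)))
  have i2 := bdd hφ.continuous hφc (integrable_inner_comp_snd hκ (Lp.memLp (H1.fn g)))
  have i3 := bdd hφ.continuous hφc (integrable_inner_comp_snd hW (Lp.memLp (H1.grad g)))
  have h0 := h φ hφ hφc hφs g
  have h0' := (integral_add i1 (i2.add i3)).symm.trans h0
  rw [add_eq_zero_iff_eq_neg] at h0'
  have e1 : ∫ t in Ioo 0 T, deriv φ t * ∫ x in Ω, ϑ t x * H1.fn g x =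
      ∫ p, deriv φ p.1 * ⟪ϑ p.1 p.2, H1.fn g p.2⟫_ℝ
        ∂((volume.restrict (Ioo 0 T)).prod (volume.restrict Ω)) := by
    rw [integral_prod _ i1]
    simp only [integral_const_mul]
    congr 1; funext t; congr 2; funext x; simp [mul_comm]
  rw [e1, h0', integral_prod _ (i2.add i3)]
  congr 1
  refine integral_congr_ae ?_
  filter_upwards [hkκ, hwW, i2.prod_right_ae, i3.prod_right_ae] with t ht1 ht2 j2 j3
  refine (integral_add j2 j3).trans ?_
  rw [add_apply, testAgainst_apply, testAgainst_apply,
    inner_slice_eq ht1, inner_slice_eq ht2, integral_const_mul, integral_const_mul, mul_add]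
  rfl

/-! ### Change of variables along the flow -/

instance {n : ℕ} : (volume : Measure (ℝ × EuclideanSpace ℝ (Fin n))).IsAddHaarMeasure := by
  rw [Measure.volume_eq_prod]
  infer_instance

/-- The matrix is block triangular with the entry `1` in the time corner. -/
theorem det_fst_prod {E : Type*} [NormedAddCommGroup E] [NormedSpace ℝ E] [FiniteDimensional ℝ E]
    (L : ℝ × E →L[ℝ] E) :
    ((ContinuousLinearMap.fst ℝ ℝ E).prod L).det =
      (L.comp (ContinuousLinearMap.inr ℝ ℝ E)).det := by
  let b := Module.Free.chooseBasis ℝ E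
  let b₁ := Module.Basis.singleton Unit ℝ
  rw [ContinuousLinearMap.det, ContinuousLinearMap.det, ← LinearMap.det_toMatrix (b₁.prod b),
    ← LinearMap.det_toMatrix b]
  have h1 : LinearMap.toMatrix (b₁.prod b) (b₁.prod b)
      (((ContinuousLinearMap.fst ℝ ℝ E).prod L : ℝ × E →L[ℝ] ℝ × E) : ℝ × E →ₗ[ℝ] ℝ × E) =
      Matrix.fromBlocks 1 0 (Matrix.of fun i _ => b.repr (L (1, 0)) i)
        (LinearMap.toMatrix b b (L.comp (ContinuousLinearMap.inr ℝ ℝ E))) := by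
    ext i j
    rcases i with i | i <;> rcases j with j | j <;> simp [LinearMap.toMatrix_apply, b₁]
  rw [h1, Matrix.det_fromBlocks_zero₁₂, Matrix.det_one, one_mul]

section Motion

variable {n : ℕ} {T : ℝ} {Φ Γ : ℝ → EuclideanSpace ℝ (Fin n) → EuclideanSpace ℝ (Fin n)}

theorem IsMotion.contDiffAt (h : IsMotion 1 (Ioo 0 T) Φ Γ) {t : ℝ} (ht : t ∈ Ioo 0 T)
    (y : EuclideanSpace ℝ (Fin n)) : ContDiffAt ℝ 1 (Function.uncurry Φ) (t, y) :=
  h.contDiffOn.contDiffAt ((isOpen_Ioo.prod isOpen_univ).mem_nhds ⟨ht, mem_univ _⟩)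

theorem IsMotion.hasFDerivAt (h : IsMotion 1 (Ioo 0 T) Φ Γ) {t : ℝ} (ht : t ∈ Ioo 0 T)
    (y : EuclideanSpace ℝ (Fin n)) : HasFDerivAt (Function.uncurry Φ)
      (fderiv ℝ (Function.uncurry Φ) (t, y)) (t, y) :=
  ((h.contDiffAt ht y).differentiableAt (by simp)).hasFDerivAt

theorem IsMotion.hasFDerivAt_space (h : IsMotion 1 (Ioo 0 T) Φ Γ) {t : ℝ} (ht : t ∈ Ioo 0 T)
    (y : EuclideanSpace ℝ (Fin n)) : HasFDerivAt (Φ t)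
      ((fderiv ℝ (Function.uncurry Φ) (t, y)).comp (ContinuousLinearMap.inr ℝ ℝ _)) y :=
  (h.hasFDerivAt ht y).comp y (hasFDerivAt_prodMk_right t y)

theorem IsMotion.hasDerivAt_time (h : IsMotion 1 (Ioo 0 T) Φ Γ) {t : ℝ} (ht : t ∈ Ioo 0 T)
    (y : EuclideanSpace ℝ (Fin n)) : HasDerivAt (fun s => Φ s y)
      (fderiv ℝ (Function.uncurry Φ) (t, y) (1, 0)) t := by
  have h1 := (h.hasFDerivAt ht y).comp_hasDerivAt t
    ((hasDerivAt_id t).prodMk (hasDerivAt_const t y))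
  exact h1

theorem IsMotion.velocity_apply (h : IsMotion 1 (Ioo 0 T) Φ Γ) {t : ℝ} (ht : t ∈ Ioo 0 T)
    (y : EuclideanSpace ℝ (Fin n)) :
    velocity Φ Γ t (Φ t y) = fderiv ℝ (Function.uncurry Φ) (t, y) (1, 0) := by
  rw [velocity, h.leftInverse t ht y]
  exact (h.hasDerivAt_time ht y).deriv

theorem fderiv_comp_fderiv_inverse {Ψ Λ : EuclideanSpace ℝ (Fin n) → EuclideanSpace ℝ (Fin n)}
    (hΨ : Differentiable ℝ Ψ) (hΛ : Differentiable ℝ Λ) (h : Function.LeftInverse Λ Ψ)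
    (y : EuclideanSpace ℝ (Fin n)) :
    |(fderiv ℝ Ψ y).det| * |(fderiv ℝ Λ (Ψ y)).det| = 1 := by
  have h1 : (fderiv ℝ Λ (Ψ y)).comp (fderiv ℝ Ψ y) = ContinuousLinearMap.id ℝ _ := by
    rw [← fderiv_comp y (hΛ _) (hΨ _), h.comp_eq_id, fderiv_id]
  have h2 := congrArg ContinuousLinearMap.det h1
  rw [ContinuousLinearMap.det, ContinuousLinearMap.toLinearMap_comp, LinearMap.det_comp] at h2
  rw [mul_comm, ← abs_mul]
  simpa [ContinuousLinearMap.det] using congrArg abs h2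

theorem IsMotion.differentiable (h : IsMotion 1 (Ioo 0 T) Φ Γ) {t : ℝ} (ht : t ∈ Ioo 0 T) :
    Differentiable ℝ (Φ t) := fun y => (h.hasFDerivAt_space ht y).differentiableAt

theorem IsMotion.det_mul_det (h : IsMotion 1 (Ioo 0 T) Φ Γ) {t : ℝ} (ht : t ∈ Ioo 0 T)
    (y : EuclideanSpace ℝ (Fin n)) :
    |(fderiv ℝ (Φ t) y).det| * |(fderiv ℝ (Γ t) (Φ t y)).det| = 1 :=
  fderiv_comp_fderiv_inverse (h.differentiable ht)
    ((h.contDiff_inverse t ht).differentiable (by simp)) (h.leftInverse t ht) y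

/-- The flow on space-time. -/
def spaceTimeFlow (Φ : ℝ → EuclideanSpace ℝ (Fin n) → EuclideanSpace ℝ (Fin n))
    (p : ℝ × EuclideanSpace ℝ (Fin n)) : ℝ × EuclideanSpace ℝ (Fin n) := (p.1, Φ p.1 p.2)

theorem IsMotion.image_spaceTimeFlow (h : IsMotion 1 (Ioo 0 T) Φ Γ) :
    spaceTimeFlow Φ '' (Ioo 0 T ×ˢ univ) = Ioo 0 T ×ˢ univ := by
  ext ⟨t, x⟩
  constructor
  · rintro ⟨⟨s, y⟩, hs, hp⟩
    obtain ⟨rfl, _⟩ := Prod.mk.inj hp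
    exact ⟨hs.1, mem_univ _⟩
  · rintro ⟨ht, _⟩
    exact ⟨(t, Γ t x), ⟨ht, mem_univ _⟩, Prod.ext rfl (h.rightInverse t ht x)⟩

theorem IsMotion.injOn_spaceTimeFlow (h : IsMotion 1 (Ioo 0 T) Φ Γ) :
    InjOn (spaceTimeFlow Φ) (Ioo 0 T ×ˢ univ) := by
  rintro ⟨t, y⟩ ht ⟨s, z⟩ hs hp
  obtain ⟨h1, h2⟩ := Prod.mk.inj hp
  simp only at h1 h2
  subst h1
  exact Prod.ext rfl ((h.leftInverse t ht.1).injective h2)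

theorem IsMotion.hasFDerivAt_spaceTimeFlow (h : IsMotion 1 (Ioo 0 T) Φ Γ)
    {p : ℝ × EuclideanSpace ℝ (Fin n)} (hp : p ∈ Ioo 0 T ×ˢ (univ : Set (EuclideanSpace ℝ (Fin n)))) :
    HasFDerivAt (spaceTimeFlow Φ)
      ((ContinuousLinearMap.fst ℝ ℝ _).prod (fderiv ℝ (Function.uncurry Φ) p)) p :=
  hasFDerivAt_fst.prodMk (h.hasFDerivAt hp.1 p.2)

theorem IsMotion.abs_det_smul (h : IsMotion 1 (Ioo 0 T) Φ Γ) {F : Type*} [NormedAddCommGroup F]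
    [NormedSpace ℝ F] (q : ℝ × EuclideanSpace ℝ (Fin n) → F)
    {p : ℝ × EuclideanSpace ℝ (Fin n)} (hp : p ∈ Ioo 0 T ×ˢ (univ : Set (EuclideanSpace ℝ (Fin n)))) :
    |((ContinuousLinearMap.fst ℝ ℝ _).prod (fderiv ℝ (Function.uncurry Φ) p)).det| •
      (|(fderiv ℝ (Γ (spaceTimeFlow Φ p).1) (spaceTimeFlow Φ p).2).det| • q (spaceTimeFlow Φ p)) =
      q (p.1, Φ p.1 p.2) := by
  rw [det_fst_prod, ← (h.hasFDerivAt_space hp.1 p.2).fderiv, smul_smul]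
  rw [show (spaceTimeFlow Φ p).1 = p.1 from rfl, show (spaceTimeFlow Φ p).2 = Φ p.1 p.2 from rfl,
    h.det_mul_det hp.1, one_smul]
  rfl

/-- The area formula on space-time needs no measurability of `q`. It thus transfers a.e.
measurability between the two coordinate systems although no joint regularity of `Γ` in `(t, x)` is
assumed. -/
theorem IsMotion.integrableOn_iff (h : IsMotion 1 (Ioo 0 T) Φ Γ) {F : Type*} [NormedAddCommGroup F]
    [NormedSpace ℝ F] (q : ℝ × EuclideanSpace ℝ (Fin n) → F) :
    IntegrableOn (fun p => |(fderiv ℝ (Γ p.1) p.2).det| • q p) (Ioo 0 T ×ˢ univ) ↔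
      IntegrableOn (fun p => q (p.1, Φ p.1 p.2)) (Ioo 0 T ×ˢ univ) := by
  have hS : MeasurableSet (Ioo 0 T ×ˢ (univ : Set (EuclideanSpace ℝ (Fin n)))) :=
    measurableSet_Ioo.prod MeasurableSet.univ
  have h1 := integrableOn_image_iff_integrableOn_abs_det_fderiv_smul volume hS
    (fun p hp => (h.hasFDerivAt_spaceTimeFlow hp).hasFDerivWithinAt) h.injOn_spaceTimeFlow
    (fun p => |(fderiv ℝ (Γ p.1) p.2).det| • q p)
  rw [h.image_spaceTimeFlow] at h1
  rw [h1]
  exact integrableOn_congr_fun (fun p hp => h.abs_det_smul q hp) hS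

theorem IsMotion.integral_eq (h : IsMotion 1 (Ioo 0 T) Φ Γ) {F : Type*} [NormedAddCommGroup F]
    [NormedSpace ℝ F] (q : ℝ × EuclideanSpace ℝ (Fin n) → F) :
    ∫ p in Ioo 0 T ×ˢ univ, |(fderiv ℝ (Γ p.1) p.2).det| • q p =
      ∫ p in Ioo 0 T ×ˢ univ, q (p.1, Φ p.1 p.2) := by
  have hS : MeasurableSet (Ioo 0 T ×ˢ (univ : Set (EuclideanSpace ℝ (Fin n)))) :=
    measurableSet_Ioo.prod MeasurableSet.univ
  have h1 := integral_image_eq_integral_abs_det_fderiv_smul volume hS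
    (fun p hp => (h.hasFDerivAt_spaceTimeFlow hp).hasFDerivWithinAt) h.injOn_spaceTimeFlow
    (fun p => |(fderiv ℝ (Γ p.1) p.2).det| • q p)
  rw [h.image_spaceTimeFlow] at h1
  rw [h1]
  exact setIntegral_congr_fun hS (fun p hp => h.abs_det_smul q hp)

/-- Integration by parts along a trajectory. -/
theorem IsMotion.integral_along_trajectory (h : IsMotion 1 (Ioo 0 T) Φ Γ)
    {φ : ℝ → ℝ} (hφ : ContDiff ℝ ∞ φ) (hφc : HasCompactSupport φ) (hφs : tsupport φ ⊆ Ioo 0 T)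
    {m m' : ℝ → ℝ} (hm : ∀ t ∈ Ioo 0 T, HasDerivAt m (m' t) t) (hm' : ContinuousOn m' (Ioo 0 T))
    {G : EuclideanSpace ℝ (Fin n) → ℝ} (hG : ContDiff ℝ ∞ G) (y : EuclideanSpace ℝ (Fin n)) :
    ∫ t in Ioo 0 T, ((deriv φ t * m t + φ t * m' t) * G (Φ t y) +
      φ t * m t * ⟪velocity Φ Γ t (Φ t y), gradient G (Φ t y)⟫_ℝ) = 0 := by
  set q : ℝ → ℝ := fun t => (deriv φ t * m t + φ t * m' t) * G (Φ t y) +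
      φ t * m t * ⟪velocity Φ Γ t (Φ t y), gradient G (Φ t y)⟫_ℝ with hq
  have hφ0 : ∀ t, t ∉ tsupport φ → φ t = 0 ∧ deriv φ t = 0 := fun t ht =>
    ⟨image_eq_zero_of_notMem_tsupport ht, by
      by_contra hc
      exact ht (support_deriv_subset hc)⟩
  have hqs : tsupport q ⊆ tsupport φ := by
    refine closure_minimal (fun t ht => ?_) (isClosed_tsupport φ)
    by_contra hc
    exact ht (by simp [hq, hφ0 t hc])
  -- The product is differentiable on the whole line: off the support of `φ` it vanishes locally, so
  -- `Φ` and `m` are never needed outside `(0,T)`.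
  have hder : ∀ t, HasDerivAt (fun t => φ t * m t * G (Φ t y)) (q t) t := by
    intro t
    by_cases ht : t ∈ tsupport φ
    · have h1 := h.hasDerivAt_time (hφs ht) y
      have h2 := ((hG.differentiable (by simp) (Φ t y)).hasFDerivAt.comp_hasDerivAt t h1)
      have h3 := (((hφ.differentiable (by simp) t).hasDerivAt.mul (hm t (hφs ht))).mul h2)
      refine h3.congr_deriv ?_
      rw [hq]
      simp only
      rw [h.velocity_apply (hφs ht), real_inner_comm]
      simp [gradient]
    · have h1 : (fun t => φ t * m t * G (Φ t y)) =ᶠ[nhds t] fun _ => 0 := by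
        filter_upwards [(isClosed_tsupport φ).isOpen_compl.mem_nhds ht] with s hs
        simp [(hφ0 s hs).1]
      refine ((hasDerivAt_const t (0 : ℝ)).congr_of_eventuallyEq h1).congr_deriv ?_
      simp [hq, hφ0 t ht]
  have hΦc : ContinuousOn (fun t => Φ t y) (Ioo 0 T) := fun t ht =>
    (h.hasDerivAt_time ht y).continuousAt.continuousWithinAt
  have hVc : ContinuousOn (fun t => velocity Φ Γ t (Φ t y)) (Ioo 0 T) := by
    have h1 : ContinuousOn (fun t => fderiv ℝ (Function.uncurry Φ) (t, y) (1, 0)) (Ioo 0 T) := by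
      have h2 := h.contDiffOn.continuousOn_fderiv_of_isOpen (isOpen_Ioo.prod isOpen_univ) le_rfl
      exact (h2.comp (Continuous.prodMk_left y).continuousOn
        (fun t ht => ⟨ht, mem_univ _⟩)).clm_apply continuousOn_const
    exact h1.congr fun t ht => h.velocity_apply ht y
  have hmc : ContinuousOn m (Ioo 0 T) := fun t ht => (hm t ht).continuousAt.continuousWithinAt
  have hqc : Continuous q := by
    refine ContinuousOn.continuous_of_tsupport_subset ?_ isOpen_Ioo (hqs.trans hφs)
    have c1 := (hφ.continuous_deriv (by simp)).continuousOn (s := Ioo 0 T)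
    have c2 := hφ.continuous.continuousOn (s := Ioo 0 T)
    exact (((c1.mul hmc).add (c2.mul hm')).mul (hG.continuous.comp_continuousOn hΦc)).add
      ((c2.mul hmc).mul (hVc.inner
        ((gradient_continuous_of_smooth hG).comp_continuousOn hΦc)))
  have hqcs : HasCompactSupport q := hφc.of_isClosed_subset (isClosed_tsupport q) hqs
  have hpc : Continuous fun t => φ t * m t * G (Φ t y) :=
    continuous_iff_continuousAt.2 fun t => (hder t).continuousAt
  have hz := integral_eq_zero_of_hasDerivAt_of_integrable hder
    (hqc.integrable_of_hasCompactSupport hqcs)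
    (hpc.integrable_of_hasCompactSupport ((hφc.mul_right (f' := m)).mul_right))
  refine Eq.trans ?_ hz
  exact setIntegral_eq_integral_of_forall_compl_eq_zero fun t ht =>
    by_contra fun hc => ht (hφs (hqs (subset_tsupport q hc)))

end Motion

/-! ### Transported densities and trajectories inside `Ω` -/

section SpaceTime

variable {n : ℕ} {T : ℝ} {Φ Γ : ℝ → EuclideanSpace ℝ (Fin n) → EuclideanSpace ℝ (Fin n)}
  {Ω : Set (EuclideanSpace ℝ (Fin n))}

theorem prod_restrict_univ (T : ℝ) :
    (volume.restrict (Ioo 0 T)).prod (volume : Measure (EuclideanSpace ℝ (Fin n))) =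
      volume.restrict (Ioo 0 T ×ˢ univ) := by
  rw [Measure.volume_eq_prod, ← Measure.prod_restrict, Measure.restrict_univ]

theorem prod_restrict_restrict (T : ℝ) (Ω : Set (EuclideanSpace ℝ (Fin n))) :
    (volume.restrict (Ioo 0 T)).prod (volume.restrict Ω) =
      volume.restrict (Ioo 0 T ×ˢ Ω) := by
  rw [Measure.volume_eq_prod, ← Measure.prod_restrict]

theorem memLp_of_eq_zero_off {F : Type*} [NormedAddCommGroup F] {r : ENNReal}
    (hΩ : MeasurableSet Ω) {q : ℝ × EuclideanSpace ℝ (Fin n) → F}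
    (hq : MemLp q r (volume.restrict (Ioo 0 T ×ˢ Ω)))
    (h0 : ∀ p : ℝ × EuclideanSpace ℝ (Fin n), p.1 ∈ Ioo 0 T → q p ≠ 0 → p.2 ∈ Ω) :
    MemLp q r (volume.restrict (Ioo 0 T ×ˢ univ)) := by
  have hS : MeasurableSet (Ioo 0 T ×ˢ (univ : Set (EuclideanSpace ℝ (Fin n)))) :=
    measurableSet_Ioo.prod MeasurableSet.univ
  have hU : MeasurableSet ((univ : Set ℝ) ×ˢ Ω) := MeasurableSet.univ.prod hΩ
  have h1 : MemLp (((univ : Set ℝ) ×ˢ Ω).indicator q) r (volume.restrict (Ioo 0 T ×ˢ univ)) := by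
    rw [memLp_indicator_iff_restrict hU, Measure.restrict_restrict hU, prod_inter_prod]
    simpa using hq
  refine (memLp_congr_ae ?_).1 h1
  filter_upwards [ae_restrict_mem hS] with p hp
  by_cases hx : p.2 ∈ Ω
  · simp [indicator, hx]
  · have : q p = 0 := by_contra fun hc => hx (h0 p hp.1 hc)
    simp [indicator, hx, this]

/-- The density with initial profile `ξ` and weight `m`, transported by the motion. -/
noncomputable def transported (Γ : ℝ → EuclideanSpace ℝ (Fin n) → EuclideanSpace ℝ (Fin n))
    (ξ : EuclideanSpace ℝ (Fin n) → ℝ) (m : ℝ → EuclideanSpace ℝ (Fin n) → ℝ)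
    (p : ℝ × EuclideanSpace ℝ (Fin n)) : ℝ :=
  |(fderiv ℝ (Γ p.1) p.2).det| • (ξ (Γ p.1 p.2) * m p.1 (Γ p.1 p.2))

theorem StaysIn.mem_of_ne_zero (h : IsMotion 1 (Ioo 0 T) Φ Γ)
    {ξ : EuclideanSpace ℝ (Fin n) → ℝ} (hs : StaysIn (Ioo 0 T) Ω Φ ξ)
    {p : ℝ × EuclideanSpace ℝ (Fin n)} (hp : p.1 ∈ Ioo 0 T) (h0 : ξ (Γ p.1 p.2) ≠ 0) :
    p.2 ∈ Ω := by
  have := hs p.1 hp _ h0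
  rwa [h.rightInverse p.1 hp] at this

theorem transported_ne_zero {ξ : EuclideanSpace ℝ (Fin n) → ℝ}
    {m : ℝ → EuclideanSpace ℝ (Fin n) → ℝ} {p : ℝ × EuclideanSpace ℝ (Fin n)}
    (h : transported Γ ξ m p ≠ 0) : ξ (Γ p.1 p.2) ≠ 0 := by
  intro h0
  exact h (by simp [transported, h0])

/-- The size is a pointwise comparison. Measurability is the delicate point: it is clear in the
coordinates `(t, y)`, and integrability there carries it back to `(t, x)`. -/
theorem IsMotion.memLp_transported_deriv (h : IsMotion 1 (Ioo 0 T) Φ Γ)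
    {ξ : EuclideanSpace ℝ (Fin n) → ℝ} (hξ : AEStronglyMeasurable ξ volume)
    {m m' : ℝ → EuclideanSpace ℝ (Fin n) → ℝ}
    (hm' : ContinuousOn (Function.uncurry m') (Ioo 0 T ×ˢ univ)) {C : ℝ}
    (hC : ∀ t ∈ Ioo 0 T, ∀ y, ξ y ≠ 0 → |m' t y| ≤ C * |m t y|)
    (hi : IntegrableOn (transported Γ ξ m) (Ioo 0 T ×ˢ univ))
    (h2 : MemLp (transported Γ ξ m) 2 (volume.restrict (Ioo 0 T ×ˢ univ))) :
    MemLp (transported Γ ξ m') 2 (volume.restrict (Ioo 0 T ×ˢ univ)) := by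
  have hS : MeasurableSet (Ioo 0 T ×ˢ (univ : Set (EuclideanSpace ℝ (Fin n)))) :=
    measurableSet_Ioo.prod MeasurableSet.univ
  have hΓ : ∀ (k : ℝ → EuclideanSpace ℝ (Fin n) → ℝ),
      EqOn (fun p : ℝ × EuclideanSpace ℝ (Fin n) => ξ (Γ p.1 (Φ p.1 p.2)) *
        k p.1 (Γ p.1 (Φ p.1 p.2))) (fun p => ξ p.2 * k p.1 p.2) (Ioo 0 T ×ˢ univ) := by
    intro k p hp
    simp only [h.leftInverse p.1 hp.1 p.2]
  have h1 : IntegrableOn (fun p : ℝ × EuclideanSpace ℝ (Fin n) => ξ p.2 * m p.1 p.2)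
      (Ioo 0 T ×ˢ univ) :=
    (integrableOn_congr_fun (hΓ m) hS).1 ((h.integrableOn_iff _).1 hi)
  have hbd : ∀ t ∈ Ioo 0 T, ∀ y, |ξ y * m' t y| ≤ C * |ξ y * m t y| := by
    intro t ht y
    by_cases h0 : ξ y = 0
    · simp [h0]
    · rw [abs_mul, abs_mul, mul_left_comm]
      exact mul_le_mul_of_nonneg_left (hC t ht y h0) (abs_nonneg _)
  have h3 : IntegrableOn (fun p : ℝ × EuclideanSpace ℝ (Fin n) => ξ p.2 * m' p.1 p.2)
      (Ioo 0 T ×ˢ univ) := by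
    refine (h1.norm.const_mul C).mono' ?_ ?_
    · refine AEStronglyMeasurable.mul ?_ (hm'.aestronglyMeasurable hS)
      rw [← prod_restrict_univ]
      exact hξ.comp_snd
    · filter_upwards [ae_restrict_mem hS] with p hp
      exact hbd p.1 hp.1 p.2
  have h4 : IntegrableOn (transported Γ ξ m') (Ioo 0 T ×ˢ univ) :=
    (h.integrableOn_iff _).2 ((integrableOn_congr_fun (hΓ m') hS).2 h3)
  refine h2.of_le_mul (c := C) h4.aestronglyMeasurable ?_
  filter_upwards [ae_restrict_mem hS] with p hp
  simp only [transported, norm_smul, Real.norm_eq_abs, abs_abs]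
  rw [mul_left_comm]
  exact mul_le_mul_of_nonneg_left (hbd p.1 hp.1 _) (abs_nonneg _)

/-- The weak formulation of the transport equation, restricted to the trajectories that start in a
measurable set `A`, against smooth functions. -/
theorem IsMotion.integral_transported_smooth (h : IsMotion 1 (Ioo 0 T) Φ Γ)
    {ξ : EuclideanSpace ℝ (Fin n) → ℝ} {m m' : ℝ → EuclideanSpace ℝ (Fin n) → ℝ}
    (hm : ∀ y, ∀ t ∈ Ioo 0 T, HasDerivAt (fun s => m s y) (m' t y) t)
    (hm' : ContinuousOn (Function.uncurry m') (Ioo 0 T ×ˢ univ))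
    {φ : ℝ → ℝ} (hφ : ContDiff ℝ ∞ φ) (hφc : HasCompactSupport φ) (hφs : tsupport φ ⊆ Ioo 0 T)
    {A : Set (EuclideanSpace ℝ (Fin n))}
    {G : EuclideanSpace ℝ (Fin n) → ℝ} (hG : ContDiff ℝ ∞ G)
    (hint : IntegrableOn ((spaceTimeFlow Φ '' (Ioo 0 T ×ˢ A)).indicator fun p =>
      (deriv φ p.1 * transported Γ ξ m p + φ p.1 * transported Γ ξ m' p) * G p.2 +
        φ p.1 * transported Γ ξ m p * ⟪velocity Φ Γ p.1 p.2, gradient G p.2⟫_ℝ)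
      (Ioo 0 T ×ˢ univ)) :
    ∫ p in Ioo 0 T ×ˢ univ, (spaceTimeFlow Φ '' (Ioo 0 T ×ˢ A)).indicator (fun p =>
      (deriv φ p.1 * transported Γ ξ m p + φ p.1 * transported Γ ξ m' p) * G p.2 +
        φ p.1 * transported Γ ξ m p * ⟪velocity Φ Γ p.1 p.2, gradient G p.2⟫_ℝ) p = 0 := by
  have hS : MeasurableSet (Ioo 0 T ×ˢ (univ : Set (EuclideanSpace ℝ (Fin n)))) :=
    measurableSet_Ioo.prod MeasurableSet.univ
  -- `q` is the integrand without its Jacobian factor, with the restriction to `A` absorbed into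
  -- `ξ`; `w` is `q` in the coordinates `(t, y)`.
  let q : ℝ × EuclideanSpace ℝ (Fin n) → ℝ := fun p =>
    A.indicator ξ (Γ p.1 p.2) * ((deriv φ p.1 * m p.1 (Γ p.1 p.2) + φ p.1 * m' p.1 (Γ p.1 p.2)) *
      G p.2 + φ p.1 * m p.1 (Γ p.1 p.2) * ⟪velocity Φ Γ p.1 p.2, gradient G p.2⟫_ℝ)
  let w : ℝ × EuclideanSpace ℝ (Fin n) → ℝ := fun p =>
    A.indicator ξ p.2 * ((deriv φ p.1 * m p.1 p.2 + φ p.1 * m' p.1 p.2) *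
      G (Φ p.1 p.2) + φ p.1 * m p.1 p.2 *
        ⟪velocity Φ Γ p.1 (Φ p.1 p.2), gradient G (Φ p.1 p.2)⟫_ℝ)
  have e1 : EqOn ((spaceTimeFlow Φ '' (Ioo 0 T ×ˢ A)).indicator fun p =>
      (deriv φ p.1 * transported Γ ξ m p + φ p.1 * transported Γ ξ m' p) * G p.2 +
        φ p.1 * transported Γ ξ m p * ⟪velocity Φ Γ p.1 p.2, gradient G p.2⟫_ℝ)
      (fun p => |(fderiv ℝ (Γ p.1) p.2).det| • q p) (Ioo 0 T ×ˢ univ) := by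
    rintro ⟨t, x⟩ ⟨ht, -⟩
    have hmem : (t, x) ∈ spaceTimeFlow Φ '' (Ioo 0 T ×ˢ A) ↔ Γ t x ∈ A := by
      constructor
      · rintro ⟨⟨s, y⟩, ⟨hs, hy⟩, hp⟩
        obtain ⟨h1, h2⟩ := Prod.mk.inj hp
        simp only at h1 h2 hs hy
        subst h1
        rw [← h2, h.leftInverse s hs]
        exact hy
      · intro hx
        exact ⟨(t, Γ t x), ⟨ht, hx⟩, Prod.ext rfl (h.rightInverse t ht x)⟩
    by_cases hx : Γ t x ∈ A
    · rw [indicator_of_mem (hmem.2 hx)]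
      simp only [q, transported, indicator_of_mem hx, smul_eq_mul]
      ring
    · rw [indicator_of_notMem (fun hc => hx (hmem.1 hc))]
      simp [q, indicator_of_notMem hx]
  have e2 : EqOn (fun p : ℝ × EuclideanSpace ℝ (Fin n) => q (p.1, Φ p.1 p.2)) w
      (Ioo 0 T ×ˢ univ) := by
    intro p hp
    simp only [q, w, h.leftInverse p.1 hp.1 p.2]
  have hw : IntegrableOn w (Ioo 0 T ×ˢ univ) :=
    (integrableOn_congr_fun e2 hS).1 ((h.integrableOn_iff q).1
      ((integrableOn_congr_fun e1 hS).1 hint))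
  rw [setIntegral_congr_fun hS e1, h.integral_eq q, setIntegral_congr_fun hS e2,
    ← prod_restrict_univ, integral_prod_symm]
  -- With time as the inner variable, the integral already vanishes for every single starting point.
  · refine integral_eq_zero_of_ae (Filter.Eventually.of_forall fun y => ?_)
    simp only [w, integral_const_mul]
    rw [h.integral_along_trajectory hφ hφc hφs (m := fun t => m t y) (m' := fun t => m' t y)
      (hm y) (hm'.comp (Continuous.prodMk_left y).continuousOn (fun t ht => ⟨ht, mem_univ _⟩)) hG y]
    simp
  · rwa [prod_restrict_univ]

/-- The starting points whose trajectories keep a distance `δ` from the complement of `Ω` during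
the times in `K`. -/
def keepsDistance (Φ : ℝ → EuclideanSpace ℝ (Fin n) → EuclideanSpace ℝ (Fin n))
    (Ω : Set (EuclideanSpace ℝ (Fin n))) (K : Set ℝ) (δ : ℝ) : Set (EuclideanSpace ℝ (Fin n)) :=
  {y | ∀ t ∈ K, ∀ z ∈ Ωᶜ, δ ≤ dist z (Φ t y)}

theorem IsMotion.isClosed_keepsDistance (h : IsMotion 1 (Ioo 0 T) Φ Γ) {K : Set ℝ}
    (hK : K ⊆ Ioo 0 T) (δ : ℝ) : IsClosed (keepsDistance Φ Ω K δ) := by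
  have : keepsDistance Φ Ω K δ = ⋂ t ∈ K, ⋂ z ∈ Ωᶜ, {y | δ ≤ dist z (Φ t y)} := by
    ext y
    simp [keepsDistance]
  rw [this]
  exact isClosed_biInter fun t ht => isClosed_biInter fun z _ => isClosed_le continuous_const
    (continuous_const.dist (h.differentiable (hK ht)).continuous)

/-- The trajectory over `K` is a compact subset of the open set `Ω`, hence has a thickening inside
`Ω`. -/
theorem IsMotion.eventually_mem_keepsDistance (h : IsMotion 1 (Ioo 0 T) Φ Γ) (hΩ : IsOpen Ω)
    {K : Set ℝ} (hKc : IsCompact K) (hK : K ⊆ Ioo 0 T) {y : EuclideanSpace ℝ (Fin n)}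
    (hy : ∀ t ∈ Ioo 0 T, Φ t y ∈ Ω) :
    ∀ᶠ k : ℕ in Filter.atTop, y ∈ keepsDistance Φ Ω K (1 / ((k : ℝ) + 1)) := by
  have hc : ContinuousOn (fun t => Φ t y) K := fun t ht =>
    (h.hasDerivAt_time (hK ht) y).continuousAt.continuousWithinAt
  obtain ⟨δ, hδ, hsub⟩ := (hKc.image_of_continuousOn hc).exists_thickening_subset_open hΩ
    (image_subset_iff.2 fun t ht => hy t (hK ht))
  have hlim : Filter.Tendsto (fun k : ℕ => 1 / ((k : ℝ) + 1)) Filter.atTop (nhds 0) :=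
    tendsto_one_div_add_atTop_nhds_zero_nat
  filter_upwards [hlim.eventually (gt_mem_nhds hδ)] with k hk t ht z hz
  by_contra hc
  refine hz (hsub (Metric.mem_thickening_iff.2 ⟨Φ t y, mem_image_of_mem _ ht, ?_⟩))
  exact (not_le.1 hc).trans hk

end SpaceTime

/-! ### The transport equation tested against `H¹(Ω)` -/

section Transport

variable {n : ℕ} {T : ℝ} {Φ Γ : ℝ → EuclideanSpace ℝ (Fin n) → EuclideanSpace ℝ (Fin n)}
  {Ω : Set (EuclideanSpace ℝ (Fin n))}

theorem MeasureTheory.MemLp.mul_comp_fst {F : Type*} [NormedAddCommGroup F] [NormedSpace ℝ F]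
    {π : Measure (ℝ × EuclideanSpace ℝ (Fin n))} {r : ENNReal}
    {q : ℝ × EuclideanSpace ℝ (Fin n) → F} (hq : MemLp q r π) {ψ : ℝ → ℝ}
    (hψ : Continuous ψ) (hψc : HasCompactSupport ψ) : MemLp (fun p => ψ p.1 • q p) r π := by
  obtain ⟨C, hC⟩ := hψc.exists_bound_of_continuous hψ
  refine hq.of_le_mul (c := C) ((hψ.comp continuous_fst).aestronglyMeasurable.smul hq.1)
    (Filter.Eventually.of_forall fun p => ?_)
  rw [norm_smul]
  exact mul_le_mul_of_nonneg_right (hC p.1) (norm_nonneg _)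

theorem integrable_indicator_inner_comp_snd {α β F : Type*} [MeasurableSpace α]
    [MeasurableSpace β] {μ : Measure α} {ν : Measure β} [IsFiniteMeasure μ] [SFinite ν]
    [NormedAddCommGroup F] [InnerProductSpace ℝ F] {u : α × β → F} (hu : MemLp u 2 (μ.prod ν))
    {Z : Set (α × β)} (hZ : MeasurableSet Z) {k : β → F} (hk : MemLp k 2 ν) :
    Integrable (fun p => ⟪Z.indicator u p, k p.2⟫_ℝ) (μ.prod ν) :=
  integrable_inner_of_memLp (f := Z.indicator u) (g := fun p : α × β => k p.2) (hu.indicator hZ)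
    (hk.comp_snd μ)

theorem real_inner_eq_mul (a b : ℝ) : ⟪a, b⟫_ℝ = a * b := by
  simp [mul_comm]

theorem IsMotion.integral_indicator_transported (h : IsMotion 1 (Ioo 0 T) Φ Γ)
    {ξ : EuclideanSpace ℝ (Fin n) → ℝ} {m m' : ℝ → EuclideanSpace ℝ (Fin n) → ℝ}
    (hm : ∀ y, ∀ t ∈ Ioo 0 T, HasDerivAt (fun s => m s y) (m' t y) t)
    (hm' : ContinuousOn (Function.uncurry m') (Ioo 0 T ×ˢ univ)) {φ : ℝ → ℝ}
    (hf : MemLp (fun p : ℝ × EuclideanSpace ℝ (Fin n) =>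
      deriv φ p.1 * transported Γ ξ m p + φ p.1 * transported Γ ξ m' p) 2
      ((volume.restrict (Ioo 0 T)).prod volume))
    (hH : MemLp (fun p : ℝ × EuclideanSpace ℝ (Fin n) =>
      φ p.1 • transported Γ ξ m p • velocity Φ Γ p.1 p.2) 2
      ((volume.restrict (Ioo 0 T)).prod volume))
    {A : Set (EuclideanSpace ℝ (Fin n))} (hZ : MeasurableSet (spaceTimeFlow Φ '' (Ioo 0 T ×ˢ A)))
    (hφ : ContDiff ℝ ∞ φ) (hφc : HasCompactSupport φ) (hφs : tsupport φ ⊆ Ioo 0 T)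
    {G : EuclideanSpace ℝ (Fin n) → ℝ} (hG : ContDiff ℝ ∞ G) (hGc : HasCompactSupport G) :
    ∫ p, (⟪(spaceTimeFlow Φ '' (Ioo 0 T ×ˢ A)).indicator (fun p =>
        deriv φ p.1 * transported Γ ξ m p + φ p.1 * transported Γ ξ m' p) p, G p.2⟫_ℝ +
      ⟪(spaceTimeFlow Φ '' (Ioo 0 T ×ˢ A)).indicator (fun p =>
        φ p.1 • transported Γ ξ m p • velocity Φ Γ p.1 p.2) p, gradient G p.2⟫_ℝ)
      ∂((volume.restrict (Ioo 0 T)).prod volume) = 0 := by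
  have hG2 : MemLp G 2 (volume : Measure (EuclideanSpace ℝ (Fin n))) :=
    hG.continuous.memLp_of_hasCompactSupport hGc
  have hG3 : MemLp (gradient G) 2 volume := (gradient_continuous_of_smooth
    hG).memLp_of_hasCompactSupport (gradient_hasCompactSupport hGc)
  have hi1 := integrable_indicator_inner_comp_snd hf hZ hG2
  have hi2 := integrable_indicator_inner_comp_snd hH hZ hG3
  have heq : ∀ p, ⟪(spaceTimeFlow Φ '' (Ioo 0 T ×ˢ A)).indicator (fun p =>
        deriv φ p.1 * transported Γ ξ m p + φ p.1 * transported Γ ξ m' p) p, G p.2⟫_ℝ +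
      ⟪(spaceTimeFlow Φ '' (Ioo 0 T ×ˢ A)).indicator (fun p =>
        φ p.1 • transported Γ ξ m p • velocity Φ Γ p.1 p.2) p, gradient G p.2⟫_ℝ =
      (spaceTimeFlow Φ '' (Ioo 0 T ×ˢ A)).indicator (fun p =>
        (deriv φ p.1 * transported Γ ξ m p + φ p.1 * transported Γ ξ m' p) * G p.2 +
        φ p.1 * transported Γ ξ m p * ⟪velocity Φ Γ p.1 p.2, gradient G p.2⟫_ℝ) p := by
    intro p
    by_cases hp : p ∈ spaceTimeFlow Φ '' (Ioo 0 T ×ˢ A)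
    · rw [indicator_of_mem hp, indicator_of_mem hp, indicator_of_mem hp, real_inner_smul_left,
        real_inner_smul_left, real_inner_eq_mul]
      ring
    · rw [indicator_of_notMem hp, indicator_of_notMem hp, indicator_of_notMem hp, inner_zero_left,
        inner_zero_left, add_zero]
  have hint := hi1.add hi2
  rw [prod_restrict_univ] at hint ⊢
  simp only [heq]
  refine h.integral_transported_smooth hm hm' hφ hφc hφs hG ?_
  exact hint.congr (Filter.Eventually.of_forall heq)

/-- The weak formulation of the transport equation against functions in `H¹(Ω)`. -/
theorem IsMotion.integral_transported_sobolev (h : IsMotion 1 (Ioo 0 T) Φ Γ) (hΩ : IsOpen Ω)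
    (hΩb : Bornology.IsBounded Ω)
    {ξ : EuclideanSpace ℝ (Fin n) → ℝ} (hs : StaysIn (Ioo 0 T) Ω Φ ξ)
    {m m' : ℝ → EuclideanSpace ℝ (Fin n) → ℝ}
    (hm : ∀ y, ∀ t ∈ Ioo 0 T, HasDerivAt (fun s => m s y) (m' t y) t)
    (hm' : ContinuousOn (Function.uncurry m') (Ioo 0 T ×ˢ univ))
    (hθ : MemLp (transported Γ ξ m) 2 (volume.restrict (Ioo 0 T ×ˢ univ)))
    (hκ : MemLp (transported Γ ξ m') 2 (volume.restrict (Ioo 0 T ×ˢ univ)))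
    (hW : MemLp (fun p : ℝ × EuclideanSpace ℝ (Fin n) =>
      transported Γ ξ m p • velocity Φ Γ p.1 p.2) 2 (volume.restrict (Ioo 0 T ×ˢ univ)))
    {φ : ℝ → ℝ} (hφ : ContDiff ℝ ∞ φ) (hφc : HasCompactSupport φ) (hφs : tsupport φ ⊆ Ioo 0 T)
    {u : EuclideanSpace ℝ (Fin n) → ℝ} {U : EuclideanSpace ℝ (Fin n) → EuclideanSpace ℝ (Fin n)}
    (hu : MemLp u 2 (volume.restrict Ω)) (hU : MemLp U 2 (volume.restrict Ω))
    (huU : IsWeakGradient Ω u U) :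
    ∫ p, (⟪deriv φ p.1 * transported Γ ξ m p + φ p.1 * transported Γ ξ m' p, u p.2⟫_ℝ +
      ⟪φ p.1 • transported Γ ξ m p • velocity Φ Γ p.1 p.2, U p.2⟫_ℝ)
      ∂((volume.restrict (Ioo 0 T)).prod (volume.restrict Ω)) = 0 := by
  set f : ℝ × EuclideanSpace ℝ (Fin n) → ℝ := fun p =>
    deriv φ p.1 * transported Γ ξ m p + φ p.1 * transported Γ ξ m' p with hf_def
  set H : ℝ × EuclideanSpace ℝ (Fin n) → EuclideanSpace ℝ (Fin n) := fun p =>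
    φ p.1 • transported Γ ξ m p • velocity Φ Γ p.1 p.2 with hH_def
  have hf : MemLp f 2 ((volume.restrict (Ioo 0 T)).prod volume) := by
    rw [prod_restrict_univ]
    exact (hθ.mul_comp_fst (hφ.continuous_deriv (by simp)) hφc.deriv).add
      (hκ.mul_comp_fst hφ.continuous hφc)
  have hH : MemLp H 2 ((volume.restrict (Ioo 0 T)).prod volume) := by
    rw [prod_restrict_univ]
    exact hW.mul_comp_fst hφ.continuous hφc
  let A : ℕ → Set (EuclideanSpace ℝ (Fin n)) := fun k =>
    keepsDistance Φ Ω (tsupport φ) (1 / ((k : ℝ) + 1))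
  let Z : ℕ → Set (ℝ × EuclideanSpace ℝ (Fin n)) := fun k =>
    spaceTimeFlow Φ '' (Ioo 0 T ×ˢ A k)
  have hZ : ∀ k, MeasurableSet (Z k) := by
    intro k
    -- Lusin–Souslin: an injective continuous image of a Borel set is Borel.
    refine (measurableSet_Ioo.prod
      (h.isClosed_keepsDistance hφs _).measurableSet).image_of_continuousOn_injOn ?_
      (h.injOn_spaceTimeFlow.mono (prod_mono le_rfl (subset_univ _)))
    exact fun p hp => (h.hasFDerivAt_spaceTimeFlow
      ⟨hp.1, mem_univ _⟩).continuousAt.continuousWithinAt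
  have hφ0 : ∀ t, t ∉ tsupport φ → φ t = 0 ∧ deriv φ t = 0 := fun t ht =>
    ⟨image_eq_zero_of_notMem_tsupport ht, by
      by_contra hc
      exact ht (support_deriv_subset hc)⟩
  have hball : ∀ k, ∀ p ∈ Z k, p.1 ∈ tsupport φ → Metric.ball p.2 (1 / ((k : ℝ) + 1)) ⊆ Ω := by
    rintro k _ ⟨⟨t, y⟩, ⟨-, hy⟩, rfl⟩ htφ z hz
    by_contra hc
    exact (not_lt.2 (hy t htφ z hc)) hz
  have hzero : ∀ k, ∫ p, (⟪(Z k).indicator f p, u p.2⟫_ℝ + ⟪(Z k).indicator H p, U p.2⟫_ℝ)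
      ∂((volume.restrict (Ioo 0 T)).prod (volume.restrict Ω)) = 0 := by
    intro k
    refine integral_prod_add_inner_eq_zero_of_smooth hΩ hΩb (hf.indicator (hZ k))
      (hH.indicator (hZ k)) (δ := 1 / ((k : ℝ) + 1)) (by positivity) ?_ ?_ ?_ hu hU huU
    · refine Filter.Eventually.of_forall fun p hp => ?_
      have hp1 : p ∈ Z k := mem_of_indicator_ne_zero hp
      refine hball k p hp1 (by_contra fun hc => hp ?_)
      simp [indicator_of_mem hp1, hf_def, hφ0 p.1 hc]
    · refine Filter.Eventually.of_forall fun p hp => ?_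
      have hp1 : p ∈ Z k := mem_of_indicator_ne_zero hp
      refine hball k p hp1 (by_contra fun hc => hp ?_)
      simp [indicator_of_mem hp1, hH_def, hφ0 p.1 hc]
    · intro G hG hGc
      exact h.integral_indicator_transported hm hm' hf hH (hZ k) hφ hφc hφs hG hGc
  have hmono : (volume.restrict (Ioo 0 T)).prod (volume.restrict Ω) ≤
      (volume.restrict (Ioo 0 T)).prod volume :=
    Measure.prod_mono le_rfl Measure.restrict_le_self
  set R : ℝ × EuclideanSpace ℝ (Fin n) → ℝ := fun p => ⟪f p, u p.2⟫_ℝ + ⟪H p, U p.2⟫_ℝ with hR_def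
  have hR : Integrable R ((volume.restrict (Ioo 0 T)).prod (volume.restrict Ω)) :=
    (integrable_inner_comp_snd (hf.mono_measure hmono) hu).add
      (integrable_inner_comp_snd (hH.mono_measure hmono) hU)
  have hind : ∀ k p, ⟪(Z k).indicator f p, u p.2⟫_ℝ + ⟪(Z k).indicator H p, U p.2⟫_ℝ =
      (Z k).indicator R p := by
    intro k p
    by_cases hp : p ∈ Z k <;> simp [hp, hR_def]
  simp only [hind] at hzero
  -- Let the distance `1 / (k + 1)` tend to zero, with `|R|` as the dominating function.
  refine tendsto_nhds_unique (tendsto_integral_of_dominated_convergence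
    (F := fun k => (Z k).indicator R) (f := R) _
    (fun k => hR.1.indicator (hZ k)) hR.norm
    (fun k => Filter.Eventually.of_forall fun p => norm_indicator_le_norm_self _ p) ?_)
    (by simp only [hzero]; exact tendsto_const_nhds)
  rw [prod_restrict_restrict]
  filter_upwards [ae_restrict_mem (measurableSet_Ioo.prod hΩ.measurableSet)] with p hp
  refine tendsto_const_nhds.congr' ?_
  -- Where `ξ` vanishes so does `R`, so membership in `Z k` is irrelevant; elsewhere the trajectory
  -- stays in `Ω` and is eventually admitted.
  by_cases h0 : ξ (Γ p.1 p.2) = 0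
  · refine Filter.Eventually.of_forall fun k => ?_
    have h1 : ∀ k, transported Γ ξ k p = 0 := fun k => by simp [transported, h0]
    have h2 : R p = 0 := by simp [R, f, H, h1]
    by_cases hpz : p ∈ Z k
    · exact (indicator_of_mem hpz R).symm
    · exact h2.trans (indicator_of_notMem hpz R).symm
  · filter_upwards [h.eventually_mem_keepsDistance hΩ hφc hφs (y := Γ p.1 p.2)
      (fun t ht => hs t ht _ h0)] with k hk
    have hpz : p ∈ Z k := ⟨(p.1, Γ p.1 p.2), ⟨hp.1, hk⟩,
      Prod.ext rfl (h.rightInverse p.1 hp.1 p.2)⟩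
    exact (indicator_of_mem hpz R).symm

/-- The common form of both cases. The bound by `C` is required only on the object, where
compactness can supply it. -/
theorem IsMotion.timeDerivMemL2Hneg1 (h : IsMotion 1 (Ioo 0 T) Φ Γ) (hΩ : IsOpen Ω)
    (hΩb : Bornology.IsBounded Ω) {γ : ℝ} [Fact (0 < γ)]
    {ξ : EuclideanSpace ℝ (Fin n) → ℝ} (hξ : AEStronglyMeasurable ξ volume)
    (hs : StaysIn (Ioo 0 T) Ω Φ ξ)
    {m m' : ℝ → EuclideanSpace ℝ (Fin n) → ℝ}
    (hm : ∀ y, ∀ t ∈ Ioo 0 T, HasDerivAt (fun s => m s y) (m' t y) t)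
    (hm' : ContinuousOn (Function.uncurry m') (Ioo 0 T ×ˢ univ)) {C : ℝ}
    (hC : ∀ t ∈ Ioo 0 T, ∀ y, ξ y ≠ 0 → |m' t y| ≤ C * |m t y|)
    {ϑ : ℝ → EuclideanSpace ℝ (Fin n) → ℝ} (hϑ : MemSpaceTimeLp 2 T Ω ϑ)
    (hV : MemSpaceTimeLp ⊤ T Ω (velocity Φ Γ))
    (hϑm : ∀ᵐ p : ℝ × EuclideanSpace ℝ (Fin n) ∂(volume.restrict (Ioo 0 T ×ˢ Ω)),
      ϑ p.1 p.2 = transported Γ ξ m p) :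
    TimeDerivMemL2Hneg1 T Ω γ ϑ := by
  have hΩm := hΩ.measurableSet
  have hoff : ∀ k, ∀ p : ℝ × EuclideanSpace ℝ (Fin n), p.1 ∈ Ioo 0 T →
      transported Γ ξ k p ≠ 0 → p.2 ∈ Ω := fun k p hp h0 =>
    hs.mem_of_ne_zero h hp (transported_ne_zero h0)
  have hfin : IsFiniteMeasure ((volume : Measure (ℝ × EuclideanSpace ℝ (Fin n))).restrict
      (Ioo 0 T ×ˢ Ω)) :=
    ⟨by simpa using ((Metric.isBounded_Ioo 0 T).prod hΩb).measure_lt_top⟩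
  have hθ' : MemLp (transported Γ ξ m) 2 (volume.restrict (Ioo 0 T ×ˢ Ω)) :=
    (memLp_congr_ae hϑm).1 hϑ
  have hθ := memLp_of_eq_zero_off hΩm hθ' (hoff m)
  -- Square integrability gives integrability on the bounded cylinder, and the density vanishes
  -- outside it.
  have hθi : IntegrableOn (transported Γ ξ m) (Ioo 0 T ×ˢ univ) :=
    memLp_one_iff_integrable.1 (memLp_of_eq_zero_off hΩm
      (memLp_one_iff_integrable.2 (hθ'.integrable (by norm_num))) (hoff m))
  have hκ := h.memLp_transported_deriv hξ hm' hC hθi hθ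
  have hW' : MemLp (fun p : ℝ × EuclideanSpace ℝ (Fin n) =>
      transported Γ ξ m p • velocity Φ Γ p.1 p.2) 2 (volume.restrict (Ioo 0 T ×ˢ Ω)) :=
    MemLp.smul (p := 2) (q := ⊤) (r := 2) (f := Function.uncurry (velocity Φ Γ)) hV hθ'
  have hW := memLp_of_eq_zero_off hΩm hW' fun p hp h0 => hoff m p hp fun hc => h0 (by simp [hc])
  have hmono : (volume.restrict (Ioo 0 T)).prod (volume.restrict Ω) ≤
      (volume : Measure (ℝ × EuclideanSpace ℝ (Fin n))).restrict (Ioo 0 T ×ˢ univ) := by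
    rw [← prod_restrict_univ]
    exact Measure.prod_mono le_rfl Measure.restrict_le_self
  refine timeDerivMemL2Hneg1_of_identity hϑ (hκ.mono_measure hmono) (hW.mono_measure hmono)
    fun φ hφ hφc hφs g => ?_
  have hmain := h.integral_transported_sobolev hΩ hΩb hs hm hm' hθ hκ hW hφ hφc hφs
    (Lp.memLp (H1.fn g)) (Lp.memLp (H1.grad g)) g.2
  refine Eq.trans (integral_congr_ae ?_) hmain
  rw [prod_restrict_restrict]
  filter_upwards [hϑm] with p hp
  rw [hp, inner_add_left, real_inner_smul_left _ _ (φ p.1)]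
  simp only [RCLike.inner_apply, conj_trivial]
  ring

end Transport

/-! ### The box as a bounded open set -/

theorem isOpen_openBox {n : ℕ} (a b : Fin n → ℝ) : IsOpen (openBox a b) := by
  have : openBox a b = ⋂ i, {x | a i < x i ∧ x i < b i} := by
    ext x
    simp [openBox]
  rw [this]
  refine isOpen_iInter_of_finite fun i => ?_
  have hc : Continuous fun x : EuclideanSpace ℝ (Fin n) => x i := by fun_prop
  exact (isOpen_lt continuous_const hc).inter (isOpen_lt hc continuous_const)

theorem isBounded_openBox {n : ℕ} (a b : Fin n → ℝ) : Bornology.IsBounded (openBox a b) := by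
  refine (((isCompact_Icc (a := a) (b := b)).image
    (EuclideanSpace.equiv (Fin n) ℝ).symm.continuous).isBounded).subset fun x hx => ?_
  exact ⟨EuclideanSpace.equiv (Fin n) ℝ x, ⟨fun i => (hx i).1.le, fun i => (hx i).2.le⟩, by simp⟩

/-! ### The Jacobian determinant and the intensity case -/

/-- By the Leibniz formula the determinant is a polynomial in the matrix entries. -/
theorem contDiff_continuousLinearMap_det {E : Type*} [NormedAddCommGroup E] [NormedSpace ℝ E]
    [FiniteDimensional ℝ E] {k : WithTop ℕ∞} :
    ContDiff ℝ k fun L : E →L[ℝ] E => L.det := by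
  let b := Module.finBasis ℝ E
  have h : (fun L : E →L[ℝ] E => L.det) = fun L =>
      ∑ σ : Equiv.Perm (Fin (Module.finrank ℝ E)), (Equiv.Perm.sign σ : ℤ) •
        ∏ i, b.equivFunL (L (b i)) (σ i) := by
    funext L
    rw [ContinuousLinearMap.det, ← LinearMap.det_toMatrix b, Matrix.det_apply]
    simp [LinearMap.toMatrix_apply, Units.smul_def]
  rw [h]
  refine ContDiff.sum fun σ _ => ContDiff.const_smul _ (contDiff_prod fun i _ => ?_)
  exact (((ContinuousLinearMap.proj (R := ℝ) (φ := fun _ => ℝ) (σ i)).comp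
    (b.equivFunL : E →L[ℝ] _)).comp (ContinuousLinearMap.apply ℝ E (b i))).contDiff

section Jacobian

variable {n : ℕ} {T : ℝ} {Φ Γ : ℝ → EuclideanSpace ℝ (Fin n) → EuclideanSpace ℝ (Fin n)}

theorem IsMotion.one_of_two (h : IsMotion 2 (Icc 0 T) Φ Γ) : IsMotion 1 (Ioo 0 T) Φ Γ where
  contDiffOn := (h.contDiffOn.of_le (by norm_num)).mono (prod_mono Ioo_subset_Icc_self le_rfl)
  contDiff_inverse t ht := (h.contDiff_inverse t (Ioo_subset_Icc_self ht)).of_le (by norm_num)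
  leftInverse t ht := h.leftInverse t (Ioo_subset_Icc_self ht)
  rightInverse t ht := h.rightInverse t (Ioo_subset_Icc_self ht)

/-- The Jacobian determinant of the motion, with its one-sided values at the end points. -/
noncomputable def jacobian (T : ℝ)
    (Φ : ℝ → EuclideanSpace ℝ (Fin n) → EuclideanSpace ℝ (Fin n))
    (p : ℝ × EuclideanSpace ℝ (Fin n)) : ℝ :=
  ((fderivWithin ℝ (Function.uncurry Φ) (Icc 0 T ×ˢ univ) p).comp
    (ContinuousLinearMap.inr ℝ ℝ _)).det

/-- The time derivative of the Jacobian determinant. -/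
noncomputable def jacobianDeriv (T : ℝ)
    (Φ : ℝ → EuclideanSpace ℝ (Fin n) → EuclideanSpace ℝ (Fin n))
    (p : ℝ × EuclideanSpace ℝ (Fin n)) : ℝ :=
  fderivWithin ℝ (jacobian T Φ) (Icc 0 T ×ˢ univ) p (1, 0)

theorem uniqueDiffOn_spaceTime (hT : 0 < T) :
    UniqueDiffOn ℝ (Icc 0 T ×ˢ (univ : Set (EuclideanSpace ℝ (Fin n)))) :=
  (uniqueDiffOn_Icc hT).prod uniqueDiffOn_univ

/-- This is where `C²` is spent: one derivative goes into the Jacobian, one is left for its time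
derivative. Derivatives within `[0,T]` keep the regularity up to the end points. -/
theorem IsMotion.contDiffOn_jacobian (hT : 0 < T) (h : IsMotion 2 (Icc 0 T) Φ Γ) :
    ContDiffOn ℝ 1 (jacobian T Φ) (Icc 0 T ×ˢ univ) := by
  have h1 : ContDiffOn ℝ 1 (fderivWithin ℝ (Function.uncurry Φ) (Icc 0 T ×ˢ univ))
      (Icc 0 T ×ˢ univ) :=
    h.contDiffOn.fderivWithin (uniqueDiffOn_spaceTime hT) (by norm_num)
  exact contDiff_continuousLinearMap_det.comp_contDiffOn (h1.clm_comp contDiffOn_const)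

theorem IsMotion.continuousOn_jacobianDeriv (hT : 0 < T) (h : IsMotion 2 (Icc 0 T) Φ Γ) :
    ContinuousOn (jacobianDeriv T Φ) (Icc 0 T ×ˢ univ) :=
  ((h.contDiffOn_jacobian hT).continuousOn_fderivWithin (uniqueDiffOn_spaceTime hT)
    le_rfl).clm_apply continuousOn_const

theorem IsMotion.hasFDerivAt_space_Icc (h : IsMotion 2 (Icc 0 T) Φ Γ) {t : ℝ} (ht : t ∈ Icc 0 T)
    (y : EuclideanSpace ℝ (Fin n)) : HasFDerivAt (Φ t)
      ((fderivWithin ℝ (Function.uncurry Φ) (Icc 0 T ×ˢ univ) (t, y)).comp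
        (ContinuousLinearMap.inr ℝ ℝ _)) y := by
  have h1 := ((h.contDiffOn.differentiableOn (by norm_num)) (t, y)
    ⟨ht, mem_univ _⟩).hasFDerivWithinAt
  have h2 := h1.comp (s := univ) y (hasFDerivAt_prodMk_right t y).hasFDerivWithinAt
    (fun z _ => ⟨ht, mem_univ _⟩)
  exact hasFDerivWithinAt_univ.1 h2

theorem IsMotion.jacobian_eq (h : IsMotion 2 (Icc 0 T) Φ Γ) {t : ℝ} (ht : t ∈ Icc 0 T)
    (y : EuclideanSpace ℝ (Fin n)) : jacobian T Φ (t, y) = (fderiv ℝ (Φ t) y).det := by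
  rw [(h.hasFDerivAt_space_Icc ht y).fderiv, jacobian]

theorem IsMotion.jacobian_ne_zero (h : IsMotion 2 (Icc 0 T) Φ Γ) {t : ℝ} (ht : t ∈ Icc 0 T)
    (y : EuclideanSpace ℝ (Fin n)) : jacobian T Φ (t, y) ≠ 0 := by
  intro h0
  have h1 := fderiv_comp_fderiv_inverse
    (fun z => (h.hasFDerivAt_space_Icc ht z).differentiableAt)
    ((h.contDiff_inverse t ht).differentiable (by norm_num)) (h.leftInverse t ht) y
  rw [← h.jacobian_eq ht, h0] at h1
  simp at h1

theorem IsMotion.hasDerivAt_jacobian (hT : 0 < T) (h : IsMotion 2 (Icc 0 T) Φ Γ) {t : ℝ}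
    (ht : t ∈ Ioo 0 T) (y : EuclideanSpace ℝ (Fin n)) :
    HasDerivAt (fun s => jacobian T Φ (s, y)) (jacobianDeriv T Φ (t, y)) t := by
  have h1 := ((h.contDiffOn_jacobian hT).differentiableOn (by norm_num) (t, y)
    ⟨Ioo_subset_Icc_self ht, mem_univ _⟩).hasFDerivWithinAt.hasFDerivAt
    (prod_mem_nhds (Icc_mem_nhds ht.1 ht.2) Filter.univ_mem)
  exact h1.comp_hasDerivAt t ((hasDerivAt_id t).prodMk (hasDerivAt_const t y))

/-- The quotient is continuous because the Jacobian never vanishes, and `[0,T] × K` is compact; an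
open time interval would not give a bound. -/
theorem IsMotion.exists_abs_jacobianDeriv_le (hT : 0 < T) (h : IsMotion 2 (Icc 0 T) Φ Γ)
    {K : Set (EuclideanSpace ℝ (Fin n))} (hK : IsCompact K) :
    ∃ C, ∀ t ∈ Icc 0 T, ∀ y ∈ K, |jacobianDeriv T Φ (t, y)| ≤ C * |jacobian T Φ (t, y)| := by
  have hc : ContinuousOn (fun p => jacobianDeriv T Φ p / jacobian T Φ p) (Icc 0 T ×ˢ K) :=
    ((h.continuousOn_jacobianDeriv hT).div (h.contDiffOn_jacobian hT).continuousOn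
      (fun p hp => h.jacobian_ne_zero hp.1 p.2)).mono (prod_mono le_rfl (subset_univ _))
  obtain ⟨C, hC⟩ := (isCompact_Icc.prod hK).exists_bound_of_continuousOn hc
  refine ⟨C, fun t ht y hy => ?_⟩
  have h1 := hC (t, y) ⟨ht, hy⟩
  rwa [Real.norm_eq_abs, abs_div, div_le_iff₀ (abs_pos.2 (h.jacobian_ne_zero ht y))] at h1

/-- The sign is written as `f / |f|`, so that continuity of the derivative is immediate where `f` is
continuous and nonzero. -/
theorem HasDerivAt.abs_of_ne_zero {f : ℝ → ℝ} {f' t : ℝ} (hf : HasDerivAt f f' t)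
    (h0 : f t ≠ 0) : HasDerivAt (fun s => |f s|) (f t * f' / |f t|) t := by
  refine ((hasDerivAt_abs h0).comp t hf).congr_deriv ?_
  have h1 : |f t| ≠ 0 := abs_ne_zero.2 h0
  rw [eq_div_iff h1]
  rcases lt_or_gt_of_ne h0 with h | h
  · simp only [sign_neg h, abs_of_neg h]
    simp [mul_comm]
  · simp only [sign_pos h, abs_of_pos h]
    simp [mul_comm]

theorem IsMotion.timeDerivMemL2Hneg1_of_intensity {Ω : Set (EuclideanSpace ℝ (Fin n))}
    (hΩ : IsOpen Ω) (hΩb : Bornology.IsBounded Ω) {γ : ℝ} [Fact (0 < γ)] (hT : 0 < T)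
    (h : IsMotion 2 (Icc 0 T) Φ Γ)
    {ξ : EuclideanSpace ℝ (Fin n) → ℝ} (hξ : AEStronglyMeasurable ξ volume)
    (hs : StaysIn (Icc 0 T) Ω Φ ξ)
    {ϑ : ℝ → EuclideanSpace ℝ (Fin n) → ℝ} (hϑ : MemSpaceTimeLp 2 T Ω ϑ)
    (hV : MemSpaceTimeLp ⊤ T Ω (velocity Φ Γ)) (hϑξ : ConservesIntensity T Ω Γ ξ ϑ) :
    TimeDerivMemL2Hneg1 T Ω γ ϑ := by
  have h1 := h.one_of_two
  have h0T : (0 : ℝ) ∈ Icc 0 T := left_mem_Icc.2 hT.le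
  -- At time `0` the object lies in `Ω`, so its starting points lie in the compact image of the
  -- closure of `Ω` under `Γ 0`.
  obtain ⟨C, hC⟩ := h.exists_abs_jacobianDeriv_le hT
    (hΩb.isCompact_closure.image (h.contDiff_inverse 0 h0T).continuous)
  have hcont : ContinuousOn (fun p => jacobian T Φ p * jacobianDeriv T Φ p / |jacobian T Φ p|)
      (Icc 0 T ×ˢ univ) :=
    ((h.contDiffOn_jacobian hT).continuousOn.mul (h.continuousOn_jacobianDeriv hT)).div
      (h.contDiffOn_jacobian hT).continuousOn.abs
      (fun p hp => abs_ne_zero.2 (h.jacobian_ne_zero hp.1 p.2))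
  refine h1.timeDerivMemL2Hneg1 hΩ hΩb hξ (fun t ht => hs t (Ioo_subset_Icc_self ht))
    (m := fun t y => |jacobian T Φ (t, y)|)
    (m' := fun t y => jacobian T Φ (t, y) * jacobianDeriv T Φ (t, y) / |jacobian T Φ (t, y)|)
    (C := C) (fun y t ht => (h.hasDerivAt_jacobian hT ht y).abs_of_ne_zero
      (h.jacobian_ne_zero (Ioo_subset_Icc_self ht) y))
    (hcont.mono (prod_mono Ioo_subset_Icc_self le_rfl)) ?_ hϑ hV ?_
  · intro t ht y hy
    have h2 : |jacobian T Φ (t, y)| ≠ 0 :=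
      abs_ne_zero.2 (h.jacobian_ne_zero (Ioo_subset_Icc_self ht) y)
    rw [abs_div, abs_mul, abs_abs, mul_div_assoc, mul_div_cancel₀ _ h2]
    exact hC t (Ioo_subset_Icc_self ht) y
      ⟨Φ 0 y, subset_closure (hs 0 h0T y hy), h.leftInverse 0 h0T y⟩
  -- The Jacobians of `Φ` and `Γ` cancel, which turns the transported density into `ξ ∘ Γ`.
  · filter_upwards [hϑξ, ae_restrict_mem (measurableSet_Ioo.prod hΩ.measurableSet)] with p hp hpm
    have h3 := h1.det_mul_det hpm.1 (Γ p.1 p.2)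
    rw [h1.rightInverse p.1 hpm.1 p.2] at h3
    rw [hp, transported, h.jacobian_eq (Ioo_subset_Icc_self hpm.1), smul_eq_mul, mul_left_comm,
      mul_comm |(fderiv ℝ (Γ p.1) p.2).det|, h3, mul_one]

end Jacobian

theorem mainTheorem10 {n : ℕ} (a b : Fin n → ℝ) (hab : ∀ i, a i < b i)
    (T : ℝ) (hT : 0 < T) (γ : ℝ) [Fact (0 < γ)]
    (Φ Γ : ℝ → EuclideanSpace ℝ (Fin n) → EuclideanSpace ℝ (Fin n))
    (ξ : EuclideanSpace ℝ (Fin n) → ℝ) (hξ : AEStronglyMeasurable ξ volume)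
    (ϑ : ℝ → EuclideanSpace ℝ (Fin n) → ℝ)
    (hϑ : MemSpaceTimeLp 2 T (openBox a b) ϑ)
    (hV : MemSpaceTimeLp ⊤ T (openBox a b) (velocity Φ Γ)) :
    (IsMotion 1 (Ioo 0 T) Φ Γ → StaysIn (Ioo 0 T) (openBox a b) Φ ξ →
      ConservesMass T (openBox a b) Γ ξ ϑ →
      TimeDerivMemL2Hneg1 T (openBox a b) γ ϑ) ∧
    (IsMotion 2 (Icc 0 T) Φ Γ → StaysIn (Icc 0 T) (openBox a b) Φ ξ →
      ConservesIntensity T (openBox a b) Γ ξ ϑ →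
      TimeDerivMemL2Hneg1 T (openBox a b) γ ϑ) := by
  refine ⟨fun h hs hm => ?_, fun h hs hi => h.timeDerivMemL2Hneg1_of_intensity
    (isOpen_openBox a b) (isBounded_openBox a b) hT hξ hs hϑ hV hi⟩
  -- Conserved mass means a constant weight along trajectories, so `κ = 0` and `C = 0` suffices.
  refine h.timeDerivMemL2Hneg1 (isOpen_openBox a b) (isBounded_openBox a b) hξ hs
    (m := fun _ _ => 1) (m' := fun _ _ => 0) (C := 0) (fun y t _ => hasDerivAt_const t 1)
    continuousOn_const (by simp) hϑ hV (hm.mono fun p hp => ?_)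
  rw [hp, transported, mul_one, smul_eq_mul, mul_comm]
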